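/- Let $d\in\mathbb N$, $s>0$, $T>0$. Write $H^s=\{f\in L^2(\mathbb R^d;\mathbb C):\|f\|_{H^s}^2=\int(1+|\xi|^{2s})|\hat f(\xi)|^2\,d\xi<\infty\}$ and $(-\Delta)^{\sigma}f=\mathcal F^{-1}(|\xi|^{2\sigma}\hat f)$, where $\hat f(\xi)=\mathcal F f(\xi)=(2\pi)^{-d/2}\int e^{-ix\cdot\xi}f(x)\,dx$. All nets are indexed by $\varepsilon\in(0,1]$. **Moderate nets.** A net $(f_\varepsilon)$ in a normed space $X$ is $X$-moderate if there are $N\in\mathbb N_0$ and $C>0$ with $\|f_\varepsilon\|_X\le C\varepsilon^{-N}$ for all $\varepsilon\in(0,1]$. A net $(u_\varepsilon)$ in $C([0,T];H^s)\cap C^1([0,T];L^2)$ is called $C([0,T];H^s)\cap C^1([0,T];L^2)$-moderate if there are $N\in\mathbb N_0$ and $C>0$ such that, for all $\varepsilon\in(0,1]$, $$\sup_{t\in[0,T]}\Big(\|u_\varepsilon(t)\|_{L^2}+\|(-\Delta)^{s/2}u_\varepsilon(t)\|_{L^2}+\|\partial_tu_\varepsilon(t)\|_{L^2}\Big)\le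 C\varepsilon^{-N}.$$ **Regularised problems.** For $a_\varepsilon,b_\varepsilon\in L^\infty(\mathbb R^d;\mathbb R)$, $u_{0,\varepsilon}\in H^s$, $u_{1,\varepsilon}\in L^2$, the regularised problem is $$\partial_t^2u_\varepsilon+(-\Delta)^su_\varepsilon+a_\varepsilon u_\varepsilon+b_\varepsilon\partial_tu_\varepsilon=0\ \text{ on }[0,T]\times\mathbb R^d,\qquad u_\varepsilon(0)=u_{0,\varepsilon},\quad \partial_tu_\varepsilon(0)=u_{1,\varepsilon}.\tag{$P_\varepsilon$}$$ A solution is a $u_\varepsilon\in C([0,T];H^s)\cap C^1([0,T];L^2)$ with these initial values which satisfies the equation in the dual of $H^s$: for all $\varphi\in H^s$ and $t\in[0,T]$, $\frac{d}{dt}\langle\varphi,\partial_tu_\varepsilon\rangle+\langle(-\Delta)^{s/2}\varphi,(-\Delta)^{s/2}u_\varepsilon\rangle+\langle\varphi,a_\varepsilon u_\varepsilon\rangle+\langle\varphi,b_\varepsilon\partial_tu_\varepsilon\rangle=0$, with $\langle\cdot,\cdot\rangle$ the inner product of $L^2$. **Approximations and very weak solutions.** The coefficients $a,b$ (real) and the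 data $u_0,u_1$ (complex) are distributions on $\mathbb R^d$ or formal finite sums and products of distributions (for example $\delta$ or $\delta^2$). An approximation of a distribution is a net of smooth functions converging to it in the sense of distributions as $\varepsilon\to0$; an approximation of a sum or product is the sum or product of approximations of its terms or factors. A very weak solution of the Cauchy problem $$u_{tt}+(-\Delta)^su+a(x)u+b(x)u_t=0,\qquad u(0,x)=u_0(x),\quad u_t(0,x)=u_1(x)\tag{P}$$ is a $C([0,T];H^s)\cap C^1([0,T];L^2)$-moderate net $(u_\varepsilon)$ for which there are $L^\infty$-moderate approximations $(a_\varepsilon)$ of $a$ and $(b_\varepsilon)$ of $b$ with $a_\varepsilon,b_\varepsilon\ge0$, an $H^s$-moderate approximation $(u_{0,\varepsilon})$ of $u_0$ and an $L^2$-moderate approximation $(u_{1,\varepsilon})$ of $u_1$ such that $u_\varepsilon$ solves $(P_\varepsilon)$ for every $\varepsilon\in(0,1]$. **Theorem.** 1. Let $(a_\varepsilon),(b_\varepsilon),(u_{0,\varepsilon}),(u_{1,\varepsilon})$ be nets that are moderate in $L^\infty,L^\infty,H^s,L^2$ respectively, with $a_\varepsilon,b_\varepsilon\ge0$. Then there is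 a net $(u_\varepsilon)$ such that $u_\varepsilon$ solves $(P_\varepsilon)$ for every $\varepsilon\in(0,1]$, and every such net is $C([0,T];H^s)\cap C^1([0,T];L^2)$-moderate. 2. Consequently, if there exist approximations of $a,b,u_0,u_1$ that are moderate in $L^\infty,L^\infty,H^s,L^2$ respectively, with $a_\varepsilon,b_\varepsilon\ge0$, then the Cauchy problem (P) has a very weak solution. -/

import Mathlib

open MeasureTheory Set Filter Topology
open scoped FourierTransform Distributions ContDiff ENNReal

noncomputable section

namespace VeryWeak

/-- The space `ℝ^d`. -/
abbrev Rn (d : ℕ) := EuclideanSpace ℝ (Fin d)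

/-- `L^2(ℝ^d)`, complex valued. -/
abbrev L2 (d : ℕ) := Lp ℂ 2 (volume : Measure (Rn d))

/-- `L^∞(ℝ^d)`, real valued (the space of the coefficients). -/
abbrev Linf (d : ℕ) := Lp ℝ ∞ (volume : Measure (Rn d))

/-! ### Sobolev spaces and the fractional Laplacian

Mathlib's Fourier transform has the kernel `exp (-2πi⟨x, ξ⟩)`, so its variable `ξ` is the frequency
`2πξ` of the convention `exp (-i⟨x, ξ⟩)`, and `-Δ` has the symbol `(2π‖ξ‖)^2`. -/

/-- `f ∈ H^s(ℝ^d)`: the integral `∫ (1 + |ξ|^{2s}) |f̂(ξ)|² dξ` is finite. -/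
def MemHs {d : ℕ} (s : ℝ) (f : L2 d) : Prop :=
  Integrable (fun ξ : Rn d => (1 + (2 * Real.pi * ‖ξ‖) ^ (2 * s)) * ‖(𝓕 f : L2 d) ξ‖ ^ 2) volume

/-- The norm of `H^s(ℝ^d)`, meaningful for `f` with `MemHs s f`. -/
def hsNorm {d : ℕ} (s : ℝ) (f : L2 d) : ℝ :=
  Real.sqrt (∫ ξ : Rn d, (1 + (2 * Real.pi * ‖ξ‖) ^ (2 * s)) * ‖(𝓕 f : L2 d) ξ‖ ^ 2)

open Classical in
/-- The fractional Laplacian `(-Δ)^σ f = 𝓕⁻¹ (|ξ|^{2σ} f̂)` as an operator in `L^2(ℝ^d)`; it has its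
meaning for the `f` whose multiplied transform `|ξ|^{2σ} f̂` lies in `L^2` (that is, on `H^{2σ}`),
and the value is `0` elsewhere. -/
def fracLaplacian {d : ℕ} (σ : ℝ) (f : L2 d) : L2 d :=
  if h : MemLp (fun ξ : Rn d => (((2 * Real.pi * ‖ξ‖) ^ (2 * σ) : ℝ) : ℂ) * (𝓕 f : L2 d) ξ) 2 volume
  then 𝓕⁻ (h.toLp _) else 0

/-! ### Solutions of the Cauchy problem with bounded coefficients -/

/-- The time derivative on `[0, T]` (one-sided at the end points). -/
def timeDeriv {d : ℕ} (T : ℝ) (u : ℝ → L2 d) (t : ℝ) : L2 d := derivWithin u (Icc 0 T) t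

/-- `u ∈ C([0,T]; H^s(ℝ^d)) ∩ C^1([0,T]; L^2(ℝ^d))`. Only the values of `u` on `[0, T]` matter. -/
structure InEnergySpace {d : ℕ} (s T : ℝ) (u : ℝ → L2 d) : Prop where
  memHs : ∀ t ∈ Icc 0 T, MemHs s (u t)
  continuous_hs : ∀ t ∈ Icc 0 T, Tendsto (fun τ => hsNorm s (u τ - u t)) (𝓝[Icc 0 T] t) (𝓝 0)
  contDiffOn : ContDiffOn ℝ 1 u (Icc 0 T)

/-- `u ∈ C([0,T]; H^s) ∩ C^1([0,T]; L^2)` solves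
`u_tt + (-Δ)^s u + a u + b u_t = 0` on `[0,T] × ℝ^d`, `u(0) = u₀`, `u_t(0) = u₁`.
For such `u` the terms `u_tt` and `(-Δ)^s u` take values in `H^{-s}`, the dual of `H^s`, and the
equation is the equation in `H^{-s}`: for all `φ ∈ H^s` and all `t ∈ [0, T]`
`d/dt ⟨φ, u_t⟩ + ⟨(-Δ)^{s/2} φ, (-Δ)^{s/2} u⟩ + ⟨φ, a u⟩ + ⟨φ, b u_t⟩ = 0`. -/
structure IsSolution {d : ℕ} (s T : ℝ) (a b : Linf d) (u₀ u₁ : L2 d) (u : ℝ → L2 d) : Prop where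
  inEnergySpace : InEnergySpace s T u
  equation : ∀ φ : L2 d, MemHs s φ → ∀ t ∈ Icc 0 T,
    HasDerivWithinAt (fun τ => inner ℂ φ (timeDeriv T u τ))
      (-(inner ℂ (fracLaplacian (s / 2) φ) (fracLaplacian (s / 2) (u t))
        + inner ℂ φ (a • u t : L2 d) + inner ℂ φ (b • timeDeriv T u t : L2 d))) (Icc 0 T) t
  initial : u 0 = u₀
  initial_deriv : timeDeriv T u 0 = u₁

/-! ### Moderate nets

A net `(f_ε)_{ε ∈ (0,1]}` is a function of `ε : ℝ` of which only the values on `(0, 1]` matter. -/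

/-- The net is `X`-moderate (used with `X = L^∞` and `X = L^2`): `‖f_ε‖ ≤ C ε^{-N}` for some `N ∈ ℕ₀` and `C > 0`. -/
def ModerateNorm {X : Type*} [NormedAddCommGroup X] (f : ℝ → X) : Prop :=
  ∃ N : ℕ, ∃ C : ℝ, 0 < C ∧ ∀ ε ∈ Ioc (0 : ℝ) 1, ‖f ε‖ ≤ C * (ε ^ N)⁻¹

/-- The net is `H^s`-moderate. -/
def ModerateHs {d : ℕ} (s : ℝ) (f : ℝ → L2 d) : Prop :=
  (∀ ε ∈ Ioc (0 : ℝ) 1, MemHs s (f ε)) ∧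
    ∃ N : ℕ, ∃ C : ℝ, 0 < C ∧ ∀ ε ∈ Ioc (0 : ℝ) 1, hsNorm s (f ε) ≤ C * (ε ^ N)⁻¹

/-- `‖u(t)‖_{L^2} + ‖(-Δ)^{s/2} u(t)‖_{L^2} + ‖u_t(t)‖_{L^2}`. -/
def energyNorm {d : ℕ} (s T : ℝ) (u : ℝ → L2 d) (t : ℝ) : ℝ :=
  ‖u t‖ + ‖fracLaplacian (s / 2) (u t)‖ + ‖timeDeriv T u t‖

/-- The net is `C([0,T]; H^s) ∩ C^1([0,T]; L^2)`-moderate: it lies in that space and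
`sup_{t ∈ [0,T]} (‖u_ε‖_{L^2} + ‖(-Δ)^{s/2} u_ε‖_{L^2} + ‖∂_t u_ε‖_{L^2}) ≤ C ε^{-N}`. -/
def ModerateEnergy {d : ℕ} (s T : ℝ) (u : ℝ → ℝ → L2 d) : Prop :=
  (∀ ε ∈ Ioc (0 : ℝ) 1, InEnergySpace s T (u ε)) ∧
    ∃ N : ℕ, ∃ C : ℝ, 0 < C ∧ ∀ ε ∈ Ioc (0 : ℝ) 1, ∀ t ∈ Icc 0 T,
      energyNorm s T (u ε) t ≤ C * (ε ^ N)⁻¹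

/-- The nets `a_ε, b_ε, u_{0,ε}, u_{1,ε}` are moderate in `L^∞, L^∞, H^s, L^2` respectively, and
`a_ε ≥ 0`, `b_ε ≥ 0`. -/
structure IsModerateData {d : ℕ} (s : ℝ) (aε bε : ℝ → Linf d) (u₀ε u₁ε : ℝ → L2 d) : Prop where
  moderate_a : ModerateNorm aε
  moderate_b : ModerateNorm bε
  moderate_u₀ : ModerateHs s u₀ε
  moderate_u₁ : ModerateNorm u₁ε
  nonneg_a : ∀ ε ∈ Ioc (0 : ℝ) 1, 0 ≤ aε ε
  nonneg_b : ∀ ε ∈ Ioc (0 : ℝ) 1, 0 ≤ bε ε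

/-- The net `(u_ε)` solves the regularised Cauchy problems for all `ε ∈ (0, 1]`. -/
def SolvesRegularised {d : ℕ} (s T : ℝ) (aε bε : ℝ → Linf d) (u₀ε u₁ε : ℝ → L2 d)
    (u : ℝ → ℝ → L2 d) : Prop :=
  ∀ ε ∈ Ioc (0 : ℝ) 1, IsSolution s T (aε ε) (bε ε) (u₀ε ε) (u₁ε ε) (u ε)

/-! ### Singular functions and their approximations -/

/-- The irregular "functions" that occur as coefficients and Cauchy data: distributions and formal
sums and products of such, for example `δ` and `δ² = δ · δ`. -/
inductive SingularFunction (d : ℕ) (𝕜 : Type) [RCLike 𝕜] : Type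
  | distribution (F : 𝓓'((⊤ : TopologicalSpace.Opens (Rn d)), 𝕜)) : SingularFunction d 𝕜
  | add (F G : SingularFunction d 𝕜) : SingularFunction d 𝕜
  | mul (F G : SingularFunction d 𝕜) : SingularFunction d 𝕜

/-- The net of smooth functions `(f_ε)_{ε ∈ (0,1]}` approximates the singular function. For a
distribution this is convergence in the sense of distributions as `ε → 0`; the approximations of a
sum or a product are the sums or products of approximations. -/
def SingularFunction.ApproxBy {d : ℕ} {𝕜 : Type} [RCLike 𝕜] :
    SingularFunction d 𝕜 → (ℝ → Rn d → 𝕜) → Prop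
  | .distribution F, f => (∀ ε ∈ Ioc (0 : ℝ) 1, ContDiff ℝ ∞ (f ε)) ∧
      ∀ φ : 𝓓((⊤ : TopologicalSpace.Opens (Rn d)), ℝ),
        Tendsto (fun ε => ∫ x, φ x • f ε x) (𝓝[>] 0) (𝓝 (F φ))
  | .add F G, f => ∃ p q : ℝ → Rn d → 𝕜, F.ApproxBy p ∧ G.ApproxBy q ∧
      ∀ ε ∈ Ioc (0 : ℝ) 1, f ε = p ε + q ε
  | .mul F G, f => ∃ p q : ℝ → Rn d → 𝕜, F.ApproxBy p ∧ G.ApproxBy q ∧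
      ∀ ε ∈ Ioc (0 : ℝ) 1, f ε = p ε * q ε

/-- The net `(g_ε)` of elements of `L^p` is (the net of classes of) an approximation of `F`. -/
def Approximates {d : ℕ} {𝕜 : Type} [RCLike 𝕜] {p : ℝ≥0∞}
    (g : ℝ → Lp 𝕜 p (volume : Measure (Rn d))) (F : SingularFunction d 𝕜) : Prop :=
  ∃ f : ℝ → Rn d → 𝕜, F.ApproxBy f ∧ ∀ ε ∈ Ioc (0 : ℝ) 1, g ε =ᵐ[volume] f ε

/-- The nets are moderate approximations to `a, b, u₀, u₁`, with `a_ε ≥ 0` and `b_ε ≥ 0`. -/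
structure IsModerateApproximation {d : ℕ} (s : ℝ) (a b : SingularFunction d ℝ)
    (u₀ u₁ : SingularFunction d ℂ) (aε bε : ℝ → Linf d) (u₀ε u₁ε : ℝ → L2 d) : Prop where
  moderate : IsModerateData s aε bε u₀ε u₁ε
  approx_a : Approximates aε a
  approx_b : Approximates bε b
  approx_u₀ : Approximates u₀ε u₀
  approx_u₁ : Approximates u₁ε u₁

/-- The net `(u_ε)` is a very weak solution of the Cauchy problem
`u_tt + (-Δ)^s u + a u + b u_t = 0`, `u(0) = u₀`, `u_t(0) = u₁`. -/
def IsVeryWeakSolution {d : ℕ} (s T : ℝ) (a b : SingularFunction d ℝ)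
    (u₀ u₁ : SingularFunction d ℂ) (u : ℝ → ℝ → L2 d) : Prop :=
  ∃ (aε bε : ℝ → Linf d) (u₀ε u₁ε : ℝ → L2 d),
    IsModerateApproximation s a b u₀ u₁ aε bε u₀ε u₁ε ∧
      SolvesRegularised s T aε bε u₀ε u₁ε u ∧ ModerateEnergy s T u

end VeryWeak

end

open VeryWeak

/-! For fixed ε the problem reads u'' + Λ²u + Au + Bu' = 0 in L², where Λ = (-Δ)^{s/2} is
self-adjoint and A, B are bounded multiplications. Formally the wave operator factors: w± = u' ± iΛu
satisfies w±' = ±iΛw± - (Au + Bu'). In the interaction picture, exp(∓itΛ)w± has a derivative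
involving bounded operators only.

This gives existence: exp(-itΛ)w₊, exp(itΛ)w₋ and u form a closed system with a continuous, globally
Lipschitz right-hand side, solved by Picard iteration
(`exists_forall_hasDerivWithinAt_of_lipschitz`). That Λu is recovered from w± follows from the
maximality of the self-adjoint Λ (`IsWaveGroup.exists_isWeakSolution`).

It also gives the energy estimate for every weak solution, although u'' exists only in the dual of
H^s. The group is isometric, so ‖w±‖² is differentiable, and half the sum of the two squares is
‖u'‖² + ‖Λu‖². Symmetry of A and positivity of B make the energy with the term ⟨u, Au⟩ nonincreasing
(`IsWeakSolution.energy_le`). Since a ≥ 0, that term can be dropped at time t. What remains is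
bounded polynomially in ‖a‖, ‖u₀‖_{H^s}, ‖u₁‖, uniformly in b (`IsSolution.energyNorm_le`), and
polynomials of moderate quantities are moderate. As the estimate covers all solutions, every net of
solutions is moderate without recourse to uniqueness. -/

namespace VeryWeak

/-! ### Lipschitz ordinary differential equations in Banach spaces -/

section ODE

variable {X : Type*} [NormedAddCommGroup X] [NormedSpace ℝ X]

/-- The Picard map in the variables `Y t = exp (-ℓ t) • Z t`, in which it is a contraction for
large `ℓ`. -/
noncomputable def picardIntegrand {T : ℝ} (hT : 0 ≤ T) (ℓ : ℝ) (F : ℝ → X → X)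
    (Y : C(Icc 0 T, X)) (τ : ℝ) : X :=
  F τ (Real.exp (ℓ * τ) • Y (projIcc 0 T hT τ))

lemma continuous_picardIntegrand {T : ℝ} (hT : 0 ≤ T) (ℓ : ℝ) {F : ℝ → X → X}
    (hF : Continuous (Function.uncurry F)) (Y : C(Icc 0 T, X)) :
    Continuous (picardIntegrand hT ℓ F Y) := by
  have h : Continuous fun τ : ℝ => (τ, Real.exp (ℓ * τ) • Y (projIcc 0 T hT τ)) := by
    have := continuous_projIcc (h := hT)
    fun_prop
  exact hF.comp h

/-- Source of the factor 1/ℓ that makes the weighted Picard map contract on an interval of any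
length. -/
lemma integral_const_mul_exp {ℓ : ℝ} (hℓ : ℓ ≠ 0) (c t : ℝ) :
    ∫ τ in (0 : ℝ)..t, c * Real.exp (ℓ * τ) = c / ℓ * (Real.exp (ℓ * t) - 1) := by
  have h : ∀ x ∈ uIcc 0 t, HasDerivAt (fun τ => c / ℓ * Real.exp (ℓ * τ))
      (c * Real.exp (ℓ * x)) x := by
    intro x _
    have h1 := (((hasDerivAt_id x).const_mul ℓ).exp).const_mul (c / ℓ)
    convert! h1 using 1
    simp only [id]
    field_simp
  rw [intervalIntegral.integral_eq_sub_of_hasDerivAt h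
    (Continuous.intervalIntegrable (by fun_prop) _ _)]
  simp
  ring

/-- Global existence for ordinary differential equations with a Lipschitz right-hand side. -/
theorem exists_forall_hasDerivWithinAt_of_lipschitz [CompleteSpace X] {T : ℝ} (hT : 0 ≤ T)
    {F : ℝ → X → X} (hF : Continuous (Function.uncurry F)) {L : ℝ} (hL : 0 ≤ L)
    (hLip : ∀ t x y, ‖F t x - F t y‖ ≤ L * ‖x - y‖) (x₀ : X) :
    ∃ Z : ℝ → X, Z 0 = x₀ ∧
      ∀ t ∈ Icc 0 T, HasDerivWithinAt Z (F t (Z t)) (Icc 0 T) t := by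
  -- The contraction constant is L / ℓ ≤ 1/2; the summand 1 keeps ℓ positive when L = 0.
  set ℓ : ℝ := 2 * L + 1 with hℓ
  have hℓ0 : 0 < ℓ := by positivity
  set G := picardIntegrand hT ℓ F with hG
  have hGc : ∀ Y, Continuous (G Y) := continuous_picardIntegrand hT ℓ hF
  have hI : ∀ Y : C(Icc 0 T, X), ∀ t, HasDerivAt (fun t => x₀ + ∫ τ in (0 : ℝ)..t, G Y τ) (G Y t) t :=
    fun Y t => ((hGc Y).integral_hasStrictDerivAt 0 t).hasDerivAt.const_add x₀
  have hIc : ∀ Y : C(Icc 0 T, X), Continuous (fun t => x₀ + ∫ τ in (0 : ℝ)..t, G Y τ) := fun Y =>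
    continuous_iff_continuousAt.2 fun t => (hI Y t).continuousAt
  let Φ : C(Icc 0 T, X) → C(Icc 0 T, X) := fun Y =>
    ⟨fun t => Real.exp (-(ℓ * t)) • (x₀ + ∫ τ in (0 : ℝ)..t, G Y τ), by
      have := hIc Y
      exact Continuous.smul (by fun_prop) (this.comp continuous_subtype_val)⟩
  have hΦ : ContractingWith (1 / 2) Φ := by
    refine ⟨by rw [← NNReal.coe_lt_coe]; norm_num, LipschitzWith.of_dist_le_mul fun Y Y' => ?_⟩
    rw [ContinuousMap.dist_le (by positivity)]
    rintro ⟨t, ht⟩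
    have h1 : ‖∫ τ in (0 : ℝ)..t, (G Y τ - G Y' τ)‖
        ≤ ∫ τ in (0 : ℝ)..t, (L * dist Y Y') * Real.exp (ℓ * τ) := by
      refine intervalIntegral.norm_integral_le_of_norm_le ht.1 (.of_forall fun τ _ => ?_)
        (Continuous.intervalIntegrable (by fun_prop) _ _)
      refine (hLip _ _ _).trans ?_
      rw [← smul_sub, norm_smul, Real.norm_of_nonneg (Real.exp_pos _).le, ← dist_eq_norm]
      have := ContinuousMap.dist_apply_le_dist (f := Y) (g := Y') (projIcc 0 T hT τ)
      calc L * (Real.exp (ℓ * τ) * dist (Y (projIcc 0 T hT τ)) (Y' (projIcc 0 T hT τ)))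
          ≤ L * (Real.exp (ℓ * τ) * dist Y Y') := by gcongr
        _ = _ := by ring
    rw [integral_const_mul_exp hℓ0.ne'] at h1
    have h2 : Φ Y ⟨t, ht⟩ - Φ Y' ⟨t, ht⟩
        = Real.exp (-(ℓ * t)) • ∫ τ in (0 : ℝ)..t, (G Y τ - G Y' τ) := by
      rw [intervalIntegral.integral_sub ((hGc Y).intervalIntegrable _ _)
        ((hGc Y').intervalIntegrable _ _)]
      simp only [Φ, ContinuousMap.coe_mk, ← smul_sub]
      congr 1
      abel
    rw [dist_eq_norm, h2, norm_smul, Real.norm_of_nonneg (Real.exp_pos _).le]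
    have h3 : L / ℓ ≤ 1 / 2 := by rw [div_le_div_iff₀ hℓ0 two_pos]; linarith
    have h4 : Real.exp (-(ℓ * t)) * (Real.exp (ℓ * t) - 1) ≤ 1 := by
      rw [mul_sub, ← Real.exp_add, neg_add_cancel, Real.exp_zero]
      linarith [Real.exp_pos (-(ℓ * t))]
    calc Real.exp (-(ℓ * t)) * ‖∫ τ in (0 : ℝ)..t, (G Y τ - G Y' τ)‖
        ≤ Real.exp (-(ℓ * t)) * (L * dist Y Y' / ℓ * (Real.exp (ℓ * t) - 1)) := by gcongr
      _ = (L / ℓ * dist Y Y') * (Real.exp (-(ℓ * t)) * (Real.exp (ℓ * t) - 1)) := by ring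
      _ ≤ (L / ℓ * dist Y Y') * 1 := by gcongr
      _ ≤ (1 / 2 * dist Y Y') * 1 := by gcongr
      _ = _ := by simp
  have : Nonempty (C(Icc 0 T, X)) := ⟨0⟩
  obtain ⟨Y, hY⟩ : ∃ Y, Φ Y = Y := ⟨_, hΦ.fixedPoint_isFixedPt⟩
  refine ⟨fun t => x₀ + ∫ τ in (0 : ℝ)..t, G Y τ, by simp, fun t ht => ?_⟩
  have h1 : G Y t = F t (x₀ + ∫ τ in (0 : ℝ)..t, G Y τ) := by
    have h2 : Y ⟨t, ht⟩ = Real.exp (-(ℓ * t)) • (x₀ + ∫ τ in (0 : ℝ)..t, G Y τ) :=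
      (DFunLike.congr_fun hY ⟨t, ht⟩).symm
    conv_lhs => rw [hG, picardIntegrand]
    rw [projIcc_of_mem hT ht, h2, smul_smul, ← Real.exp_add, add_neg_cancel, Real.exp_zero, one_smul]
  have := (hI Y t).hasDerivWithinAt (s := Icc 0 T)
  rwa [h1] at this

end ODE

/-! ### Unitary groups and abstract damped wave equations -/

section Abstract

variable {H : Type*} [NormedAddCommGroup H] [InnerProductSpace ℂ H]

/-- `Λ` is a self-adjoint operator with domain `D` and `U t = exp (i t Λ)`. -/
structure IsWaveGroup (D : H → Prop) (Λ : H → H) (U : ℝ → H →ₗᵢ[ℂ] H) : Prop where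
  inner_apply : ∀ t x y, inner ℂ x (U t y) = inner ℂ (U (-t) x) y
  apply_neg : ∀ t x, U t (U (-t) x) = x
  continuous : ∀ x, Continuous fun t => U t x
  symm : ∀ x y, D x → D y → inner ℂ (Λ x) y = inner ℂ x (Λ y)
  maximal : ∀ x y, (∀ z, D z → inner ℂ (Λ z) x = inner ℂ z y) → D x ∧ Λ x = y
  mem_apply : ∀ t x, D x → D (U t x)
  map_apply : ∀ t x, D x → Λ (U t x) = U t (Λ x)
  tendsto_slope : ∀ t x, D x →
    Tendsto (fun τ => ((τ - t : ℝ) : ℂ)⁻¹ • (U τ x - U t x)) (𝓝[≠] t) (𝓝 (Complex.I • U t (Λ x)))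

namespace IsWaveGroup

variable {D : H → Prop} {Λ : H → H} {U : ℝ → H →ₗᵢ[ℂ] H}

lemma neg_apply (h : IsWaveGroup D Λ U) (t : ℝ) (x : H) : U (-t) (U t x) = x := by
  simpa using h.apply_neg (-t) x

/-- Neither D nor Λ is assumed linear: Λ equals its own adjoint, and adjoints are linear. -/
lemma sub (h : IsWaveGroup D Λ U) {x y : H} (hx : D x) (hy : D y) :
    D (x - y) ∧ Λ (x - y) = Λ x - Λ y :=
  h.maximal _ _ fun z hz => by
    rw [inner_sub_right, inner_sub_right, h.symm z x hz hx, h.symm z y hz hy]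

/-- Density of the domain, from maximality: if x - y is orthogonal to D, then x - y and 0 both
qualify as the value of Λ at 0. -/
lemma eq_of_forall_inner (h : IsWaveGroup D Λ U) {x y : H}
    (hxy : ∀ z, D z → inner ℂ z x = inner ℂ z y) : x = y := by
  have h0 : D 0 ∧ Λ 0 = 0 := h.maximal _ _ fun z _ => by simp
  have h1 : D 0 ∧ Λ 0 = x - y := h.maximal _ _ fun z hz => by
    rw [inner_sub_right, hxy z hz]; simp
  exact sub_eq_zero.1 (h1.2.symm.trans h0.2)

/-- The inverse group is generated by `-Λ`. -/
lemma reverse (h : IsWaveGroup D Λ U) :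
    IsWaveGroup D (fun x => -Λ x) (fun t => U (-t)) where
  inner_apply t x y := h.inner_apply (-t) x y
  apply_neg t x := h.apply_neg (-t) x
  continuous x := (h.continuous x).comp continuous_neg
  symm x y hx hy := by simp [h.symm x y hx hy]
  maximal x y hxy := by
    have := h.maximal x (-y) fun z hz => by
      have := hxy z hz
      rw [inner_neg_left] at this
      rw [inner_neg_right, ← this, neg_neg]
    exact ⟨this.1, by simp [this.2]⟩
  mem_apply t x hx := h.mem_apply _ _ hx
  map_apply t x hx := by simp [h.map_apply _ _ hx]
  tendsto_slope t x hx := by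
    have h1 : Tendsto (fun τ : ℝ => -τ) (𝓝[≠] t) (𝓝[≠] (-t)) :=
      tendsto_nhdsWithin_of_tendsto_nhds_of_eventually_within _
        ((continuous_neg.tendsto t).mono_left nhdsWithin_le_nhds)
        (by filter_upwards [self_mem_nhdsWithin] with τ hτ using by simpa using hτ)
    have h2 := ((h.tendsto_slope (-t) x hx).comp h1).neg
    simp only [map_neg, smul_neg]
    refine h2.congr fun τ => ?_
    simp only [Function.comp]
    rw [← neg_smul]
    congr 1
    push_cast
    rw [← inv_neg]
    congr 1
    ring

lemma continuous_uncurry (h : IsWaveGroup D Λ U) : Continuous fun p : ℝ × H => U p.1 p.2 := by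
  rw [continuous_iff_continuousAt]
  rintro ⟨t, x⟩
  rw [ContinuousAt, tendsto_iff_norm_sub_tendsto_zero]
  have h1 : Tendsto (fun p : ℝ × H => ‖p.2 - x‖ + ‖U p.1 x - U t x‖) (𝓝 (t, x)) (𝓝 0) := by
    have h2 : Continuous fun p : ℝ × H => ‖p.2 - x‖ + ‖U p.1 x - U t x‖ := by
      have := (h.continuous x).comp (continuous_fst (X := ℝ) (Y := H))
      exact (continuous_snd.sub continuous_const).norm.add (this.sub continuous_const).norm
    simpa using h2.tendsto (t, x)
  refine squeeze_zero (fun _ => norm_nonneg _) (fun p => ?_) h1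
  calc ‖U p.1 p.2 - U t x‖ = ‖U p.1 (p.2 - x) + (U p.1 x - U t x)‖ := by
        rw [map_sub]; congr 1; abel
    _ ≤ ‖p.2 - x‖ + ‖U p.1 x - U t x‖ := (norm_add_le _ _).trans (by rw [(U p.1).norm_map])

lemma continuousOn_apply (h : IsWaveGroup D Λ U) {r : ℝ → ℝ} (hr : Continuous r) {f : ℝ → H}
    {S : Set ℝ} (hf : ContinuousOn f S) : ContinuousOn (fun t => U (r t) (f t)) S :=
  h.continuous_uncurry.comp_continuousOn (hr.continuousOn.prodMk hf)

/-- The product rule for `⟨U(t)x, w(t)⟩`, where `w` has a weak derivative only. -/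
lemma hasDerivWithinAt_inner (h : IsWaveGroup D Λ U) {x : H} (hx : D x) {w : ℝ → H} {S : Set ℝ}
    {t : ℝ} {c : ℂ} (hw : ContinuousWithinAt w S t)
    (hc : HasDerivWithinAt (fun τ => inner ℂ (U t x) (w τ)) c S t) :
    HasDerivWithinAt (fun τ => inner ℂ (U τ x) (w τ))
      (inner ℂ (Complex.I • U t (Λ x)) (w t) + c) S t := by
  -- The quotient splits exactly into the slope of U(·)x paired with w(τ), and the slope of ⟨U(t)x,
  -- w(·)⟩. The first slope converges in norm, so continuity of w suffices there.
  rw [hasDerivWithinAt_iff_tendsto_slope] at hc ⊢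
  have h1 : Tendsto (fun τ => inner ℂ (((τ - t : ℝ) : ℂ)⁻¹ • (U τ x - U t x)) (w τ))
      (𝓝[S \ {t}] t) (𝓝 (inner ℂ (Complex.I • U t (Λ x)) (w t))) :=
    ((h.tendsto_slope t x hx).mono_left (nhdsWithin_mono _ fun y hy => hy.2)).inner
      (hw.mono_left (nhdsWithin_mono _ sdiff_subset))
  refine (h1.add hc).congr fun τ => ?_
  simp only [slope, vsub_eq_sub, inner_smul_left, inner_sub_left, Complex.real_smul, map_inv₀,
    Complex.conj_ofReal]
  push_cast
  ring

end IsWaveGroup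

/-! ### Weak solutions: interaction picture and energy -/

/-- `u` is a weak solution of `u'' + Λ² u + A u + B u' = 0` on `[0, T]`, and `v = u'`. -/
structure IsWeakSolution [NormedSpace ℝ H] (D : H → Prop) (Λ : H → H) (A B : H →L[ℝ] H) (T : ℝ)
    (u v : ℝ → H) : Prop where
  mem : ∀ t ∈ Icc 0 T, D (u t)
  continuousOn : ContinuousOn (fun t => Λ (u t)) (Icc 0 T)
  hasDerivWithinAt : ∀ t ∈ Icc 0 T, HasDerivWithinAt u (v t) (Icc 0 T) t
  continuousOn_deriv : ContinuousOn v (Icc 0 T)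
  equation : ∀ x, D x → ∀ t ∈ Icc 0 T, HasDerivWithinAt (fun τ => inner ℂ x (v τ))
    (-(inner ℂ (Λ x) (Λ (u t)) + inner ℂ x (A (u t)) + inner ℂ x (B (v t)))) (Icc 0 T) t

variable [NormedSpace ℝ H] {D : H → Prop} {Λ : H → H} {U : ℝ → H →ₗᵢ[ℂ] H} {A B : H →L[ℝ] H} {T : ℝ}
  {u v : ℝ → H}

lemma eq_of_hasDerivWithinAt_zero {E : Type*} [NormedAddCommGroup E] [NormedSpace ℝ E] {f : ℝ → E}
    (hf : ∀ t ∈ Icc 0 T, HasDerivWithinAt f 0 (Icc 0 T) t) : ∀ t ∈ Icc 0 T, f t = f 0 := by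
  refine constant_of_has_deriv_right_zero (fun t ht => (hf t ht).continuousWithinAt) fun t ht => ?_
  exact (hf t ⟨ht.1, ht.2.le⟩).mono_of_mem_nhdsWithin (Icc_mem_nhdsGE_of_mem ht)

namespace IsWeakSolution

lemma continuousOn_self (hs : IsWeakSolution D Λ A B T u v) : ContinuousOn u (Icc 0 T) :=
  fun t ht => (hs.hasDerivWithinAt t ht).continuousWithinAt

/-- Only Λ² enters the equation. Used with `IsWaveGroup.reverse`, this carries results on v + iΛu
over to v - iΛu. -/
lemma neg (hs : IsWeakSolution D Λ A B T u v) : IsWeakSolution D (fun x => -Λ x) A B T u v where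
  mem := hs.mem
  continuousOn := hs.continuousOn.neg
  hasDerivWithinAt := hs.hasDerivWithinAt
  continuousOn_deriv := hs.continuousOn_deriv
  equation x hx t ht := by simpa using hs.equation x hx t ht

/-- In the interaction picture, `v + iΛu` has a strong derivative. -/
lemma hasDerivWithinAt_interaction [CompleteSpace H] (h : IsWaveGroup D Λ U)
    (hs : IsWeakSolution D Λ A B T u v) (hT : 0 ≤ T) {t : ℝ} (ht : t ∈ Icc 0 T) :
    HasDerivWithinAt (fun τ => U (-τ) (v τ + Complex.I • Λ (u τ)))
      (-U (-t) (A (u t) + B (v t))) (Icc 0 T) t := by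
  set w : ℝ → H := fun τ => v τ + Complex.I • Λ (u τ) with hw
  set k : ℝ → H := fun τ => U (-τ) (A (u τ) + B (v τ)) with hk
  have hwc : ContinuousOn w (Icc 0 T) := hs.continuousOn_deriv.add (hs.continuousOn.const_smul _)
  have hkc : ContinuousOn k (Icc 0 T) := h.continuousOn_apply continuous_neg
    ((A.continuous.comp_continuousOn hs.continuousOn_self).add
      (B.continuous.comp_continuousOn hs.continuousOn_deriv))
  -- Constant extension beyond [0, T], so that the fundamental theorem of calculus applies at the
  -- end points too. The primitive y is the strongly differentiable candidate for U(-τ)w(τ).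
  set K : ℝ → H := IccExtend hT (fun τ : Icc 0 T => k τ) with hK
  have hKc : Continuous K := (continuousOn_iff_continuous_domRestrict.1 hkc).Icc_extend'
  have hKk : ∀ τ ∈ Icc 0 T, K τ = k τ := fun τ hτ => IccExtend_of_mem hT _ hτ
  set y : ℝ → H := fun τ => U (-0) (w 0) - ∫ r in (0 : ℝ)..τ, K r with hy
  have hyd : ∀ τ, HasDerivAt y (-K τ) τ := fun τ =>
    (hKc.integral_hasStrictDerivAt 0 τ).hasDerivAt.const_sub _
  have hzy : ∀ τ ∈ Icc 0 T, U (-τ) (w τ) = y τ := by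
    intro τ hτ
    -- Testing against the dense domain is enough: U(r)x stays in D, so it is admissible in the weak
    -- equation.
    refine h.eq_of_forall_inner fun x hx => ?_
    have hd : ∀ r ∈ Icc 0 T, HasDerivWithinAt
        (fun r => inner ℂ (U r x) (w r) - inner ℂ x (y r)) 0 (Icc 0 T) r := by
      intro r hr
      have hUx := h.mem_apply r x hx
      have h1 : HasDerivWithinAt (fun r' => inner ℂ (Λ (U r x)) (u r'))
          (inner ℂ (Λ (U r x)) (v r)) (Icc 0 T) r := by
        simpa using (hasDerivWithinAt_const r (Icc 0 T) (Λ (U r x))).inner ℂ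
          (hs.hasDerivWithinAt r hr)
      have h2 : HasDerivWithinAt (fun r' => inner ℂ (U r x) (w r'))
          (-(inner ℂ (Λ (U r x)) (Λ (u r)) + inner ℂ (U r x) (A (u r)) + inner ℂ (U r x) (B (v r)))
            + Complex.I * inner ℂ (Λ (U r x)) (v r)) (Icc 0 T) r := by
        refine ((hs.equation _ hUx r hr).add (h1.const_mul Complex.I)).congr_of_mem
          (fun r' hr' => ?_) hr
        simp only [hw, inner_add_right, inner_smul_right, Pi.add_apply]
        rw [h.symm _ _ hUx (hs.mem r' hr')]
      have h3 := h.hasDerivWithinAt_inner hx (hwc r hr) h2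
      have h4 : HasDerivWithinAt (fun r' => inner ℂ x (y r')) (inner ℂ x (-K r)) (Icc 0 T) r := by
        simpa using (hasDerivWithinAt_const r (Icc 0 T) x).inner ℂ (hyd r).hasDerivWithinAt
      convert! h3.sub h4 using 1
      rw [hKk r hr, h.map_apply r x hx]
      simp only [hw, hk, inner_smul_left, inner_neg_right, h.inner_apply (-r), neg_neg,
        inner_add_right, inner_smul_right, Complex.conj_I]
      -- All terms in Λx cancel: those from differentiating U(r)x are opposite to those from the
      -- weak equation.
      linear_combination (inner ℂ (U r (Λ x)) (Λ (u r))) * Complex.I_mul_I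
    have h5 := eq_of_hasDerivWithinAt_zero hd τ hτ
    have h6 : inner ℂ (U 0 x) (w 0) = inner ℂ x (y 0) := by
      simp only [hy, intervalIntegral.integral_same, sub_zero]
      rw [h.inner_apply, neg_neg]
    rw [h6, sub_self, sub_eq_zero] at h5
    rw [h.inner_apply, neg_neg, h5]
  have := ((hyd t).hasDerivWithinAt (s := Icc 0 T)).congr_of_mem hzy ht
  rwa [hKk t ht] at this

/-- The derivative of `‖v + iΛu‖²`. -/
lemma hasDerivWithinAt_normSq [CompleteSpace H] (h : IsWaveGroup D Λ U)
    (hs : IsWeakSolution D Λ A B T u v) (hT : 0 ≤ T) {t : ℝ} (ht : t ∈ Icc 0 T) :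
    HasDerivWithinAt (fun τ => ‖v τ + Complex.I • Λ (u τ)‖ ^ 2)
      (-2 * (inner ℂ (v t + Complex.I • Λ (u t)) (A (u t) + B (v t))).re) (Icc 0 T) t := by
  have h1 := hs.hasDerivWithinAt_interaction h hT ht
  have h2 := (Complex.reCLM.hasFDerivAt).comp_hasDerivWithinAt t (h1.inner ℂ h1)
  convert! h2 using 1
  · ext τ
    simp only [Function.comp, Complex.reCLM_apply, LinearIsometry.inner_map_map]
    exact norm_sq_eq_re_inner (𝕜 := ℂ) _
  · simp only [Complex.reCLM_apply, inner_neg_right, inner_neg_left, LinearIsometry.inner_map_map,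
      Complex.add_re, Complex.neg_re]
    have : (inner ℂ (A (u t) + B (v t)) (v t + Complex.I • Λ (u t))).re
        = (inner ℂ (v t + Complex.I • Λ (u t)) (A (u t) + B (v t))).re := inner_re_symm (𝕜 := ℂ) _ _
    rw [this]
    ring

/-- The energy of a weak solution does not increase. -/
theorem energy_le [CompleteSpace H] (h : IsWaveGroup D Λ U) (hs : IsWeakSolution D Λ A B T u v)
    (hT : 0 ≤ T) (hA : ∀ x y, inner ℂ x (A y) = inner ℂ (A x) y)
    (hB : ∀ x, 0 ≤ (inner ℂ x (B x)).re) {t : ℝ} (ht : t ∈ Icc 0 T) :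
    ‖v t‖ ^ 2 + ‖Λ (u t)‖ ^ 2 + (inner ℂ (u t) (A (u t))).re
      ≤ ‖v 0‖ ^ 2 + ‖Λ (u 0)‖ ^ 2 + (inner ℂ (u 0) (A (u 0))).re := by
  set E : ℝ → ℝ := fun t => ‖v t‖ ^ 2 + ‖Λ (u t)‖ ^ 2 + (inner ℂ (u t) (A (u t))).re with hE
  have hd : ∀ τ ∈ Icc 0 T,
      HasDerivWithinAt E (-2 * (inner ℂ (v τ) (B (v τ))).re) (Icc 0 T) τ := by
    intro τ hτ
    -- Half the sum for both signs is ‖v‖² + ‖Λu‖² by the parallelogram law, with derivative -2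
    -- Re⟨v, Au + Bv⟩. Differentiating ⟨u, Au⟩ cancels the A-term by symmetry.
    have h1 := hs.hasDerivWithinAt_normSq h hT hτ
    have h2 := hs.neg.hasDerivWithinAt_normSq h.reverse hT hτ
    have h3 := hs.hasDerivWithinAt τ hτ
    have h4 := Complex.reCLM.hasFDerivAt.comp_hasDerivWithinAt τ
      (h3.inner ℂ (A.hasFDerivAt.comp_hasDerivWithinAt τ h3))
    have h5 := ((h1.add h2).const_mul (1 / 2 : ℝ)).add h4
    convert! h5 using 1
    · ext r
      simp only [hE, Pi.add_apply, Function.comp, Complex.reCLM_apply, smul_neg, ← sub_eq_add_neg]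
      have := parallelogram_law_with_norm ℂ (v r) (Complex.I • Λ (u r))
      simp only [norm_smul, Complex.norm_I, one_mul] at this
      linear_combination (-1 / 2) * this
    · have h6 : (inner ℂ (v τ) (A (u τ))).re = (inner ℂ (u τ) (A (v τ))).re := by
        rw [hA (u τ)]; exact inner_re_symm (𝕜 := ℂ) _ _
      simp only [Complex.reCLM_apply, Function.comp, inner_add_left, inner_add_right,
        Complex.add_re, smul_neg, inner_neg_left, Complex.neg_re]
      rw [h6]
      ring
  have hanti : AntitoneOn E (Icc 0 T) := by
    refine antitoneOn_of_deriv_nonpos (convex_Icc 0 T)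
      (fun τ hτ => (hd τ hτ).continuousWithinAt) (fun τ hτ => ?_) fun τ hτ => ?_
    · exact ((hd τ (interior_subset hτ)).mono interior_subset).differentiableWithinAt
    · have := (hd τ (interior_subset hτ)).hasDerivAt (mem_interior_iff_mem_nhds.1 hτ)
      rw [this.deriv]
      have := hB (v τ)
      linarith
  exact hanti ⟨le_rfl, hT⟩ ht ht.1

end IsWeakSolution

/-- Existence of weak solutions of `u'' + Λ² u + A u + B u' = 0`. -/
theorem IsWaveGroup.exists_isWeakSolution [CompleteSpace H] (h : IsWaveGroup D Λ U) (hT : 0 ≤ T)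
    (A B : H →L[ℝ] H) {u₀ : H} (hu₀ : D u₀) (u₁ : H) :
    ∃ u v : ℝ → H, IsWeakSolution D Λ A B T u v ∧ u 0 = u₀ ∧ v 0 = u₁ := by
  -- The unknown triple stands for (U(-t)(v + iΛu), U(t)(v - iΛu), u). `V` reads off v, and Λ does
  -- not occur in the system.
  set V : ℝ → H × H × H → H := fun t p => (2 : ℂ)⁻¹ • (U t p.1 + U (-t) p.2.1) with hV
  set g : ℝ → H × H × H → H := fun t p => A p.2.2 + B (V t p) with hg
  set F : ℝ → H × H × H → H × H × H :=
    fun t p => (-U (-t) (g t p), -U t (g t p), V t p) with hF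
  have hUc := h.continuous_uncurry
  have hVc : Continuous (Function.uncurry V) := by
    have h1 : Continuous fun q : ℝ × H × H × H => U q.1 q.2.1 :=
      hUc.comp (continuous_fst.prodMk (continuous_fst.comp continuous_snd))
    have h2 : Continuous fun q : ℝ × H × H × H => U (-q.1) q.2.2.1 :=
      hUc.comp (continuous_fst.neg.prodMk (by fun_prop))
    exact (h1.add h2).const_smul _
  have hgc : Continuous (Function.uncurry g) :=
    (A.continuous.comp (by fun_prop)).add (B.continuous.comp hVc)
  have hFc : Continuous (Function.uncurry F) :=
    (hUc.comp (continuous_fst.neg.prodMk hgc)).neg.prodMk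
      ((hUc.comp (continuous_fst.prodMk hgc)).neg.prodMk hVc)
  have hVL : ∀ t p q, ‖V t p - V t q‖ ≤ ‖p - q‖ := by
    intro t p q
    have h1 : V t p - V t q = (2 : ℂ)⁻¹ • (U t (p - q).1 + U (-t) (p - q).2.1) := by
      simp only [hV, ← smul_sub, Prod.fst_sub, Prod.snd_sub, map_sub]
      congr 1
      abel
    rw [h1, norm_smul]
    have h2 : ‖U t (p - q).1 + U (-t) (p - q).2.1‖ ≤ ‖p - q‖ + ‖p - q‖ := by
      refine (norm_add_le _ _).trans (add_le_add ?_ ?_)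
      · rw [LinearIsometry.norm_map]; exact norm_fst_le _
      · rw [LinearIsometry.norm_map]; exact (norm_fst_le _).trans (norm_snd_le _)
    simp only [norm_inv, Complex.norm_ofNat]
    linarith
  have hgL : ∀ t p q, ‖g t p - g t q‖ ≤ (‖A‖ + ‖B‖) * ‖p - q‖ := by
    intro t p q
    have h1 : g t p - g t q = A (p - q).2.2 + B (V t p - V t q) := by
      simp only [hg, Prod.snd_sub, map_sub]
      abel
    rw [h1, add_mul]
    refine (norm_add_le _ _).trans (add_le_add ?_ ?_)
    · exact A.le_opNorm_of_le ((norm_snd_le _).trans (norm_snd_le _))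
    · exact B.le_opNorm_of_le (hVL t p q)
  have hFL : ∀ t p q, ‖F t p - F t q‖ ≤ (‖A‖ + ‖B‖ + 1) * ‖p - q‖ := by
    intro t p q
    have h1 := hgL t p q
    have h2 := hVL t p q
    have h3 : (‖A‖ + ‖B‖) * ‖p - q‖ ≤ (‖A‖ + ‖B‖ + 1) * ‖p - q‖ :=
      mul_le_mul_of_nonneg_right (by linarith) (norm_nonneg _)
    have h4 : ‖p - q‖ ≤ (‖A‖ + ‖B‖ + 1) * ‖p - q‖ :=
      le_mul_of_one_le_left (norm_nonneg _) (by linarith [norm_nonneg A, norm_nonneg B])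
    simp only [hF, Prod.mk_sub_mk, norm_prod_le_iff]
    refine ⟨?_, ?_, h2.trans h4⟩
    · rw [← neg_sub', norm_neg, ← map_sub, LinearIsometry.norm_map]; exact h1.trans h3
    · rw [← neg_sub', norm_neg, ← map_sub, LinearIsometry.norm_map]; exact h1.trans h3
  obtain ⟨Z, hZ0, hZ⟩ := exists_forall_hasDerivWithinAt_of_lipschitz hT hFc
    (by positivity) hFL (U (-0) (u₁ + Complex.I • Λ u₀), U 0 (u₁ - Complex.I • Λ u₀), u₀)
  set v : ℝ → H := fun t => V t (Z t) with hv
  -- The candidate for Λu, namely (w₊ - w₋)/(2i); that it is Λu is proved in `hmem`.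
  set P : ℝ → H := fun t => (2 * Complex.I)⁻¹ • (U t (Z t).1 - U (-t) (Z t).2.1) with hP
  have hZc : ContinuousOn Z (Icc 0 T) := fun t ht => (hZ t ht).continuousWithinAt
  have hd1 : ∀ t ∈ Icc 0 T, HasDerivWithinAt (fun t => (Z t).1) (-U (-t) (g t (Z t))) (Icc 0 T) t :=
    fun t ht => (hZ t ht).fst
  have hd2 : ∀ t ∈ Icc 0 T, HasDerivWithinAt (fun t => (Z t).2) (F t (Z t)).2 (Icc 0 T) t :=
    fun t ht => (hZ t ht).snd
  have hd21 : ∀ t ∈ Icc 0 T,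
      HasDerivWithinAt (fun t => (Z t).2.1) (-U t (g t (Z t))) (Icc 0 T) t :=
    fun t ht => (hd2 t ht).fst
  have hd22 : ∀ t ∈ Icc 0 T, HasDerivWithinAt (fun t => (Z t).2.2) (v t) (Icc 0 T) t :=
    fun t ht => (hd2 t ht).snd
  have hU1c : ContinuousOn (fun t => U t (Z t).1) (Icc 0 T) :=
    h.continuousOn_apply continuous_id hZc.fst
  have hU2c : ContinuousOn (fun t => U (-t) (Z t).2.1) (Icc 0 T) :=
    h.continuousOn_apply continuous_neg hZc.snd.fst
  have hvc : ContinuousOn v (Icc 0 T) := (hU1c.add hU2c).const_smul _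
  have hPc : ContinuousOn P (Icc 0 T) := (hU1c.sub hU2c).const_smul _
  have hVP1 : ∀ t, v t + Complex.I • P t = U t (Z t).1 := by
    intro t
    simp only [hv, hP, hV, smul_smul]
    rw [show Complex.I * (2 * Complex.I)⁻¹ = (2 : ℂ)⁻¹ by field_simp, ← smul_add,
      add_add_sub_cancel, ← two_smul ℂ, smul_smul]
    norm_num
  have hVP2 : ∀ t, v t - Complex.I • P t = U (-t) (Z t).2.1 := by
    intro t
    simp only [hv, hP, hV, smul_smul]
    rw [show Complex.I * (2 * Complex.I)⁻¹ = (2 : ℂ)⁻¹ by field_simp, ← smul_sub,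
      add_sub_sub_cancel, ← two_smul ℂ, smul_smul]
    norm_num
  have hi1 : ∀ x, D x → ∀ t ∈ Icc 0 T, HasDerivWithinAt (fun τ => inner ℂ x (U τ (Z τ).1))
      (Complex.I * inner ℂ (Λ x) (v t + Complex.I • P t) - inner ℂ x (g t (Z t))) (Icc 0 T) t := by
    intro x hx t ht
    have hc : HasDerivWithinAt (fun τ => inner ℂ (U (-t) x) (Z τ).1)
        (inner ℂ (U (-t) x) (-U (-t) (g t (Z t)))) (Icc 0 T) t := by
      simpa using (hasDerivWithinAt_const t (Icc 0 T) (U (-t) x)).inner ℂ (hd1 t ht)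
    have h1 := h.reverse.hasDerivWithinAt_inner hx (hd1 t ht).continuousWithinAt hc
    convert! h1 using 1
    · ext τ
      rw [h.inner_apply]
    · rw [hVP1, h.inner_apply]
      simp [inner_smul_left, sub_eq_add_neg]
  have hi2 : ∀ x, D x → ∀ t ∈ Icc 0 T, HasDerivWithinAt (fun τ => inner ℂ x (U (-τ) (Z τ).2.1))
      (-(Complex.I * inner ℂ (Λ x) (v t - Complex.I • P t)) - inner ℂ x (g t (Z t)))
      (Icc 0 T) t := by
    intro x hx t ht
    have hc : HasDerivWithinAt (fun τ => inner ℂ (U t x) (Z τ).2.1)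
        (inner ℂ (U t x) (-U t (g t (Z t)))) (Icc 0 T) t := by
      simpa using (hasDerivWithinAt_const t (Icc 0 T) (U t x)).inner ℂ (hd21 t ht)
    have h1 := h.hasDerivWithinAt_inner hx (hd21 t ht).continuousWithinAt hc
    convert! h1 using 1
    · ext τ
      rw [h.inner_apply, neg_neg]
    · rw [hVP2, h.inner_apply, neg_neg]
      simp [sub_eq_add_neg, mul_comm]
  have hu0 : (Z 0).2.2 = u₀ := by rw [hZ0]
  have hw1 : v 0 + Complex.I • P 0 = u₁ + Complex.I • Λ u₀ := by
    rw [hVP1, hZ0]; exact h.apply_neg 0 _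
  have hw2 : v 0 - Complex.I • P 0 = u₁ - Complex.I • Λ u₀ := by
    rw [hVP2, hZ0]; exact h.neg_apply 0 _
  have hv0 : v 0 = u₁ := by
    have h1 : (2 : ℂ) • v 0 = (2 : ℂ) • u₁ := by
      rw [two_smul, two_smul]
      calc v 0 + v 0 = (v 0 + Complex.I • P 0) + (v 0 - Complex.I • P 0) := by abel
        _ = _ := by rw [hw1, hw2]; abel
    exact smul_right_injective H (two_ne_zero (α := ℂ)) h1
  have hP0 : P 0 = Λ u₀ := by
    rw [hv0] at hw1
    exact smul_right_injective H Complex.I_ne_zero (add_left_cancel hw1)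
  have hmem : ∀ t ∈ Icc 0 T, D (Z t).2.2 ∧ Λ (Z t).2.2 = P t := by
    intro t ht
    -- By maximality it suffices that ⟨Λx, u⟩ = ⟨x, P⟩ for x in D. Both sides have derivative ⟨Λx,
    -- v⟩, and they agree at time 0 because P(0) = Λu₀.
    refine h.maximal _ _ fun x hx => ?_
    have hd : ∀ r ∈ Icc 0 T, HasDerivWithinAt
        (fun r => inner ℂ (Λ x) (Z r).2.2 - inner ℂ x (P r)) 0 (Icc 0 T) r := by
      intro r hr
      have h1 : HasDerivWithinAt (fun r => inner ℂ (Λ x) (Z r).2.2)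
          (inner ℂ (Λ x) (v r)) (Icc 0 T) r := by
        simpa using (hasDerivWithinAt_const r (Icc 0 T) (Λ x)).inner ℂ (hd22 r hr)
      have h2 := ((hi1 x hx r hr).sub (hi2 x hx r hr)).const_mul (2 * Complex.I)⁻¹
      convert! h1.sub h2 using 1
      · ext τ
        simp only [hP, inner_smul_right, inner_sub_right, Pi.sub_apply]
      · simp only [inner_add_right, inner_sub_right, inner_smul_right]
        field_simp
        ring
    have h5 := eq_of_hasDerivWithinAt_zero hd t ht
    rwa [hu0, hP0, h.symm x u₀ hx hu₀, sub_self, sub_eq_zero] at h5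
  refine ⟨fun t => (Z t).2.2, v, ⟨fun t ht => (hmem t ht).1, ?_, hd22, hvc, ?_⟩, hu0, hv0⟩
  · exact hPc.congr fun t ht => (hmem t ht).2
  · intro x hx t ht
    have h1 := ((hi1 x hx t ht).add (hi2 x hx t ht)).const_mul (2 : ℂ)⁻¹
    convert! h1 using 1
    · ext τ
      simp only [hv, hV, inner_smul_right, inner_add_right, Pi.add_apply]
    · rw [(hmem t ht).2]
      simp only [hg, inner_add_right, inner_sub_right, inner_smul_right]
      linear_combination -(inner ℂ (Λ x) (P t)) * Complex.I_mul_I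

end Abstract

/-! ### Multiplication operators in L² and their unitary groups -/

section Multiplication

variable {α : Type*} [MeasurableSpace α] {μ : Measure α}

lemma norm_sq_eq_integral (f : Lp ℂ 2 μ) : ‖f‖ ^ 2 = ∫ x, ‖f x‖ ^ 2 ∂μ := by
  have h1 : ((‖f‖ ^ 2 : ℝ) : ℂ) = ∫ x, ((‖f x‖ ^ 2 : ℝ) : ℂ) ∂μ := by
    push_cast
    have := inner_self_eq_norm_sq_to_K (𝕜 := ℂ) f
    rw [L2.inner_def] at this
    refine this.symm.trans (integral_congr_ae (.of_forall fun x => ?_))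
    exact inner_self_eq_norm_sq_to_K (𝕜 := ℂ) (f x)
  rw [integral_complex_ofReal] at h1
  exact_mod_cast h1

lemma integrable_norm_sq (f : Lp ℂ 2 μ) : Integrable (fun x => ‖f x‖ ^ 2) μ :=
  (memLp_two_iff_integrable_sq_norm (Lp.aestronglyMeasurable f)).1 (Lp.memLp f)

/-- Dominated convergence in `L²`. -/
lemma tendsto_Lp_of_dominated {ι : Type*} {l : Filter ι} [l.IsCountablyGenerated]
    {F : ι → Lp ℂ 2 μ} {f : Lp ℂ 2 μ} {G : ι → α → ℂ} {f₀ : α → ℂ} {g : α → ℝ}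
    (hg : Integrable (fun x => g x ^ 2) μ) (hF : ∀ i, F i =ᵐ[μ] G i) (hf : f =ᵐ[μ] f₀)
    (hb : ∀ᶠ i in l, ∀ᵐ x ∂μ, ‖G i x - f₀ x‖ ≤ g x)
    (hl : ∀ᵐ x ∂μ, Tendsto (fun i => G i x) l (𝓝 (f₀ x))) : Tendsto F l (𝓝 f) := by
  have hsub : ∀ i, (F i - f : Lp ℂ 2 μ) =ᵐ[μ] fun x => G i x - f₀ x := fun i => by
    filter_upwards [Lp.coeFn_sub (F i) f, hF i, hf] with x h1 h2 h3
    rw [h1, Pi.sub_apply, h2, h3]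
  have h1 : Tendsto (fun i => ∫ x, ‖G i x - f₀ x‖ ^ 2 ∂μ) l (𝓝 (∫ _, (0 : ℝ) ∂μ)) := by
    refine tendsto_integral_filter_of_dominated_convergence _ (.of_forall fun i => ?_) ?_ hg ?_
    · exact ((Lp.aestronglyMeasurable (F i - f)).congr (hsub i)).norm.pow 2
    · filter_upwards [hb] with i hi
      filter_upwards [hi] with x hx
      rw [norm_pow, norm_norm]
      gcongr
    · filter_upwards [hl] with x hx
      simpa using ((hx.sub_const (f₀ x)).norm.pow 2)
  have h2 : ∀ i, ‖F i - f‖ = Real.sqrt (∫ x, ‖G i x - f₀ x‖ ^ 2 ∂μ) := fun i => by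
    rw [← Real.sqrt_sq (norm_nonneg (F i - f)), norm_sq_eq_integral]
    congr 1
    refine integral_congr_ae ?_
    filter_upwards [hsub i] with x hx
    rw [hx]
  rw [tendsto_iff_norm_sub_tendsto_zero]
  simp_rw [h2]
  simpa using h1.sqrt

lemma memLp_mul_of_norm_le {k : α → ℂ} (hk : Measurable k) {C : ℝ} (hC : ∀ x, ‖k x‖ ≤ C)
    (f : Lp ℂ 2 μ) : MemLp (fun x => k x * f x) 2 μ :=
  (Lp.memLp f).of_le_mul (c := C)
    (hk.aestronglyMeasurable.mul (Lp.aestronglyMeasurable f)) (.of_forall fun x => by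
      rw [norm_mul]; gcongr; exact hC x)

lemma inner_eq_inner_of_ae {f g f' g' : Lp ℂ 2 μ}
    (h : ∀ᵐ x ∂μ, inner ℂ (f x) (g x) = inner ℂ (f' x) (g' x)) : inner ℂ f g = inner ℂ f' g' := by
  rw [L2.inner_def, L2.inner_def]
  exact integral_congr_ae h

open Classical in
/-- Multiplication by the real function `m` in `L²`, with the value `0` outside of its domain. -/
noncomputable def mulOp (m : α → ℝ) (f : Lp ℂ 2 μ) : Lp ℂ 2 μ :=
  if h : MemLp (fun x => (m x : ℂ) * f x) 2 μ then h.toLp _ else 0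

lemma coeFn_mulOp {m : α → ℝ} {f : Lp ℂ 2 μ} (h : MemLp (fun x => (m x : ℂ) * f x) 2 μ) :
    mulOp m f =ᵐ[μ] fun x => (m x : ℂ) * f x := by
  rw [mulOp, dif_pos h]
  exact h.coeFn_toLp

variable {m : α → ℝ} (hm : Measurable m)

lemma measurable_exp_mul {m : α → ℝ} (hm : Measurable m) (t : ℝ) :
    Measurable fun x => Complex.exp (Complex.I * (t * m x : ℝ)) := by
  fun_prop

lemma memLp_exp_mul {m : α → ℝ} (hm : Measurable m) (t : ℝ) (f : Lp ℂ 2 μ) :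
    MemLp (fun x => Complex.exp (Complex.I * (t * m x : ℝ)) * f x) 2 μ :=
  memLp_mul_of_norm_le (measurable_exp_mul hm t)
    (fun _ => (Complex.norm_exp_I_mul_ofReal _).le) f

/-- The unitary group `exp (i t m)` of multiplication operators in `L²`. -/
noncomputable def expMul (t : ℝ) : Lp ℂ 2 μ →ₗᵢ[ℂ] Lp ℂ 2 μ where
  toFun f := (memLp_exp_mul hm t f).toLp _
  map_add' f g := by
    rw [← MemLp.toLp_add]
    apply MemLp.toLp_congr
    filter_upwards [Lp.coeFn_add f g] with x hx
    rw [hx, Pi.add_apply, Pi.add_apply, mul_add]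
  map_smul' c f := by
    rw [RingHom.id_apply, ← MemLp.toLp_const_smul]
    apply MemLp.toLp_congr
    filter_upwards [Lp.coeFn_smul c f] with x hx
    simp [hx, mul_left_comm]
  norm_map' f := by
    rw [← sq_eq_sq₀ (norm_nonneg _) (norm_nonneg _), norm_sq_eq_integral, norm_sq_eq_integral]
    refine integral_congr_ae ?_
    filter_upwards [(memLp_exp_mul hm t f).coeFn_toLp] with x hx
    simp only [LinearMap.coe_mk, AddHom.coe_mk]
    rw [hx, norm_mul, Complex.norm_exp_I_mul_ofReal, one_mul]

lemma coeFn_expMul (t : ℝ) (f : Lp ℂ 2 μ) :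
    expMul hm t f =ᵐ[μ] fun x => Complex.exp (Complex.I * (t * m x : ℝ)) * f x :=
  (memLp_exp_mul hm t f).coeFn_toLp

lemma norm_exp_sub_exp_le (t τ a : ℝ) :
    ‖Complex.exp (Complex.I * (τ * a : ℝ)) - Complex.exp (Complex.I * (t * a : ℝ))‖
      ≤ |τ - t| * |a| := by
  have h : Complex.exp (Complex.I * (τ * a : ℝ)) - Complex.exp (Complex.I * (t * a : ℝ))
      = Complex.exp (Complex.I * (t * a : ℝ))
        * (Complex.exp (Complex.I * ((τ - t) * a : ℝ)) - 1) := by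
    rw [mul_sub, ← Complex.exp_add, mul_one]
    push_cast
    ring_nf
  rw [h, norm_mul, Complex.norm_exp_I_mul_ofReal, one_mul, ← abs_mul]
  exact Real.norm_exp_I_mul_ofReal_sub_one_le

lemma hasDerivAt_exp_mul (a t : ℝ) :
    HasDerivAt (fun t : ℝ => Complex.exp (Complex.I * (t * a : ℝ)))
      (Complex.I * (Complex.exp (Complex.I * (t * a : ℝ)) * a)) t := by
  have h1 : HasDerivAt (fun t : ℝ => Complex.I * ((t * a : ℝ) : ℂ)) (Complex.I * ((1 * a : ℝ) : ℂ)) t :=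
    (((hasDerivAt_id t).mul_const a).ofReal_comp).const_mul _
  convert! h1.cexp using 1
  push_cast
  ring

/-- Testing with h/(1 + m), which lies in the domain for every h in L², gives m f/(1 + m) = g/(1 +
m) in L². Hence m f = g almost everywhere, and m f is square integrable. -/
lemma mulOp_maximal (hm0 : ∀ x, 0 ≤ m x) (hm : Measurable m) {f g : Lp ℂ 2 μ}
    (hfg : ∀ h : Lp ℂ 2 μ, MemLp (fun x => (m x : ℂ) * h x) 2 μ →
      inner ℂ (mulOp m h) f = inner ℂ h g) :
    MemLp (fun x => (m x : ℂ) * f x) 2 μ ∧ mulOp m f = g := by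
  have hpos : ∀ x, 0 < 1 + m x := fun x => by linarith [hm0 x]
  set r : α → ℝ := fun x => (1 + m x)⁻¹ with hr
  have hr1 : Measurable fun x => (r x : ℂ) := by fun_prop
  have hr2 : ∀ x, ‖(r x : ℂ)‖ ≤ 1 := fun x => by
    rw [Complex.norm_real, Real.norm_of_nonneg (inv_nonneg.2 (hpos x).le)]
    exact inv_le_one_of_one_le₀ (by linarith [hm0 x])
  have hq1 : Measurable fun x => ((m x * r x : ℝ) : ℂ) := by fun_prop
  have hq2 : ∀ x, ‖((m x * r x : ℝ) : ℂ)‖ ≤ 1 := fun x => by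
    rw [Complex.norm_real, Real.norm_of_nonneg (mul_nonneg (hm0 x) (inv_nonneg.2 (hpos x).le)),
      mul_inv_le_iff₀ (hpos x)]
    linarith
  have hR := fun h : Lp ℂ 2 μ => memLp_mul_of_norm_le hr1 hr2 h
  have hQ := fun h : Lp ℂ 2 μ => memLp_mul_of_norm_le hq1 hq2 h
  have key : (hQ f).toLp _ = (hR g).toLp _ := by
    refine ext_inner_left ℂ fun h => ?_
    have h1 : (fun x => (m x : ℂ) * (hR h).toLp _ x) =ᵐ[μ] fun x => ((m x * r x : ℝ) : ℂ) * h x := by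
      filter_upwards [(hR h).coeFn_toLp] with x hx
      rw [hx]
      push_cast
      ring
    have h2 : MemLp (fun x => (m x : ℂ) * (hR h).toLp _ x) 2 μ := (hQ h).ae_eq h1.symm
    have h3 : inner ℂ h ((hQ f).toLp _) = inner ℂ (mulOp m ((hR h).toLp _)) f := by
      refine inner_eq_inner_of_ae ?_
      filter_upwards [coeFn_mulOp h2, h1, (hQ f).coeFn_toLp] with x e1 e2 e3
      rw [e1, e2, e3]
      simp only [RCLike.inner_apply, map_mul, Complex.conj_ofReal]
      ring
    have h4 : inner ℂ h ((hR g).toLp _) = inner ℂ ((hR h).toLp _) g := by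
      refine inner_eq_inner_of_ae ?_
      filter_upwards [(hR h).coeFn_toLp, (hR g).coeFn_toLp] with x e1 e2
      rw [e1, e2]
      simp only [RCLike.inner_apply, map_mul, Complex.conj_ofReal]
      ring
    rw [h3, h4, hfg _ h2]
  have hae : g =ᵐ[μ] fun x => (m x : ℂ) * f x := by
    have h1 : (hQ f).toLp _ =ᵐ[μ] (hR g).toLp _ := by rw [key]
    filter_upwards [h1, (hQ f).coeFn_toLp, (hR g).coeFn_toLp] with x e1 e2 e3
    rw [e2, e3] at e1
    have hrx : (r x : ℂ) ≠ 0 := Complex.ofReal_ne_zero.2 (inv_ne_zero (hpos x).ne')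
    apply mul_left_cancel₀ hrx
    rw [← e1]
    push_cast
    ring
  have hf : MemLp (fun x => (m x : ℂ) * f x) 2 μ := (Lp.memLp g).ae_eq hae
  exact ⟨hf, Lp.ext ((coeFn_mulOp hf).trans hae.symm)⟩

/-- Multiplication by a non-negative function generates a unitary group. -/
theorem isWaveGroup_mulOp (hm0 : ∀ x, 0 ≤ m x) :
    IsWaveGroup (fun f : Lp ℂ 2 μ => MemLp (fun x => (m x : ℂ) * f x) 2 μ) (mulOp m)
      (expMul (μ := μ) hm) where
  inner_apply t f g := by
    refine inner_eq_inner_of_ae ?_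
    filter_upwards [coeFn_expMul hm t g, coeFn_expMul hm (-t) f] with x e1 e2
    rw [e1, e2]
    simp only [RCLike.inner_apply, map_mul, ← Complex.exp_conj, Complex.conj_ofReal,
      Complex.conj_I]
    push_cast
    ring_nf
  apply_neg t f := by
    refine Lp.ext ?_
    filter_upwards [coeFn_expMul hm t (expMul hm (-t) f), coeFn_expMul hm (-t) f] with x e1 e2
    rw [e1, e2, ← mul_assoc, ← Complex.exp_add]
    push_cast
    ring_nf
    simp
  continuous f := by
    rw [continuous_iff_continuousAt]
    intro t
    refine tendsto_Lp_of_dominated (g := fun x => 2 * ‖f x‖) ?_ (fun τ => coeFn_expMul hm τ f)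
      (coeFn_expMul hm t f) (.of_forall fun τ => .of_forall fun x => ?_) (.of_forall fun x => ?_)
    · simpa only [mul_pow] using (integrable_norm_sq f).const_mul _
    · refine (norm_sub_le _ _).trans ?_
      simp only [norm_mul, Complex.norm_exp_I_mul_ofReal]
      linarith
    · exact ((hasDerivAt_exp_mul (m x) t).continuousAt.mul_const (f x))
  symm f g hf hg := by
    refine inner_eq_inner_of_ae ?_
    filter_upwards [coeFn_mulOp hf, coeFn_mulOp hg] with x e1 e2
    rw [e1, e2]
    simp only [RCLike.inner_apply, map_mul, Complex.conj_ofReal]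
    ring
  maximal f g hfg := mulOp_maximal hm0 hm hfg
  mem_apply t f hf := by
    refine hf.congr_norm (by
      exact (Complex.measurable_ofReal.comp hm).aestronglyMeasurable.mul
        (Lp.aestronglyMeasurable _)) ?_
    filter_upwards [coeFn_expMul hm t f] with x e1
    rw [e1]
    simp only [norm_mul, Complex.norm_exp_I_mul_ofReal, one_mul]
  map_apply t f hf := by
    have hf' : MemLp (fun x => (m x : ℂ) * expMul hm t f x) 2 μ := by
      refine hf.congr_norm (by
        exact (Complex.measurable_ofReal.comp hm).aestronglyMeasurable.mul
          (Lp.aestronglyMeasurable _)) ?_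
      filter_upwards [coeFn_expMul hm t f] with x e1
      rw [e1]
      simp only [norm_mul, Complex.norm_exp_I_mul_ofReal, one_mul]
    refine Lp.ext ?_
    filter_upwards [coeFn_mulOp hf', coeFn_expMul hm t f, coeFn_expMul hm t (mulOp m f),
      coeFn_mulOp hf] with x e1 e2 e3 e4
    rw [e1, e2, e3, e4]
    ring
  tendsto_slope t f hf := by
    -- Difference quotients of exp(itm) and their limit are each bounded by |m|, whence the factor
    -- 2.
    refine tendsto_Lp_of_dominated (g := fun x => 2 * ‖(m x : ℂ) * f x‖)
      (G := fun τ x => ((τ - t : ℝ) : ℂ)⁻¹ * (Complex.exp (Complex.I * (τ * m x : ℝ))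
        - Complex.exp (Complex.I * (t * m x : ℝ))) * f x)
      (f₀ := fun x => Complex.I * (Complex.exp (Complex.I * (t * m x : ℝ)) * m x) * f x)
      ?_ (fun τ => ?_) ?_ ?_ (.of_forall fun x => ?_)
    · simpa only [mul_pow] using
        ((memLp_two_iff_integrable_sq_norm hf.aestronglyMeasurable).1 hf).const_mul (2 ^ 2)
    · filter_upwards [Lp.coeFn_smul ((τ - t : ℝ) : ℂ)⁻¹ (expMul hm τ f - expMul hm t f),
        Lp.coeFn_sub (expMul hm τ f) (expMul hm t f), coeFn_expMul hm τ f,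
        coeFn_expMul hm t f] with x e1 e2 e3 e4
      rw [e1, Pi.smul_apply, e2, Pi.sub_apply, e3, e4, smul_eq_mul]
      ring
    · filter_upwards [Lp.coeFn_smul Complex.I (expMul hm t (mulOp m f)),
        coeFn_expMul hm t (mulOp m f), coeFn_mulOp hf] with x e1 e2 e3
      rw [e1, Pi.smul_apply, e2, e3, smul_eq_mul]
      ring
    · filter_upwards [self_mem_nhdsWithin] with τ hτ
      refine .of_forall fun x => ?_
      have hτ' : 0 < |τ - t| := abs_pos.2 (sub_ne_zero.2 hτ)
      have h1 := norm_exp_sub_exp_le t τ (m x)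
      refine (norm_sub_le _ _).trans ?_
      simp only [norm_mul, Complex.norm_exp_I_mul_ofReal, Complex.norm_I, one_mul, norm_inv,
        Complex.norm_real, Real.norm_eq_abs]
      have h2 : |τ - t|⁻¹ * ‖Complex.exp (Complex.I * (τ * m x : ℝ))
          - Complex.exp (Complex.I * (t * m x : ℝ))‖ ≤ |m x| := by
        rw [inv_mul_le_iff₀ hτ']
        exact h1
      have h3 := mul_le_mul_of_nonneg_right h2 (norm_nonneg (f x))
      linarith
    · have h1 := (hasDerivAt_iff_tendsto_slope.1 (hasDerivAt_exp_mul (m x) t)).mul_const (f x)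
      refine h1.congr fun τ => ?_
      rw [slope, vsub_eq_sub, Complex.real_smul]
      push_cast
      ring

end Multiplication

/-- Wave groups are transported by unitary maps. -/
lemma IsWaveGroup.conj {H K : Type*} [NormedAddCommGroup H] [InnerProductSpace ℂ H]
    [NormedAddCommGroup K] [InnerProductSpace ℂ K] {D : H → Prop} {Λ : H → H}
    {U : ℝ → H →ₗᵢ[ℂ] H} (h : IsWaveGroup D Λ U) (Φ : K ≃ₗᵢ[ℂ] H) :
    IsWaveGroup (fun x => D (Φ x)) (fun x => Φ.symm (Λ (Φ x)))
      (fun t => Φ.symm.toLinearIsometry.comp ((U t).comp Φ.toLinearIsometry)) := by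
  have hl : ∀ x y, inner ℂ x (Φ.symm y) = inner ℂ (Φ x) y := fun x y => by
    rw [← Φ.inner_map_map, Φ.apply_symm_apply]
  have hr : ∀ x y, inner ℂ (Φ.symm x) y = inner ℂ x (Φ y) := fun x y => by
    rw [← Φ.inner_map_map, Φ.apply_symm_apply]
  constructor
  · intro t x y
    simp [hl, hr, h.inner_apply]
  · intro t x
    simp [h.apply_neg]
  · intro x
    exact Φ.symm.continuous.comp (h.continuous (Φ x))
  · intro x y hx hy
    simp only [hl, hr]
    exact h.symm _ _ hx hy
  · intro x y hxy
    have := h.maximal (Φ x) (Φ y) fun z hz => by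
      have := hxy (Φ.symm z) (by simpa using hz)
      simpa [hl, hr] using this
    exact ⟨this.1, by rw [this.2, Φ.symm_apply_apply]⟩
  · intro t x hx
    simpa using h.mem_apply t _ hx
  · intro t x hx
    simp [h.map_apply t _ hx]
  · intro t x hx
    have := (Φ.symm.continuous.tendsto _).comp (h.tendsto_slope t (Φ x) hx)
    simpa [Function.comp_def] using this

/-! ### The fractional Laplacian as generator of a unitary group -/

variable {d : ℕ}

/-- The symbol of `(-Δ)^{s/2}`. -/
noncomputable def fracSymbol (d : ℕ) (s : ℝ) (ξ : Rn d) : ℝ := (2 * Real.pi * ‖ξ‖) ^ (2 * (s / 2))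

lemma measurable_fracSymbol (d : ℕ) (s : ℝ) : Measurable (fracSymbol d s) := by
  unfold fracSymbol
  fun_prop

lemma fracSymbol_nonneg (s : ℝ) (ξ : Rn d) : 0 ≤ fracSymbol d s ξ := by
  unfold fracSymbol
  positivity

lemma fracSymbol_sq (s : ℝ) (ξ : Rn d) :
    fracSymbol d s ξ ^ 2 = (2 * Real.pi * ‖ξ‖) ^ (2 * s) := by
  rw [fracSymbol, ← Real.rpow_natCast, ← Real.rpow_mul (by positivity)]
  congr 1
  push_cast
  ring

lemma sobolev_integrand_eq (s : ℝ) (f : L2 d) (ξ : Rn d) :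
    (1 + (2 * Real.pi * ‖ξ‖) ^ (2 * s)) * ‖(𝓕 f : L2 d) ξ‖ ^ 2
      = ‖(𝓕 f : L2 d) ξ‖ ^ 2 + ‖(fracSymbol d s ξ : ℂ) * (𝓕 f : L2 d) ξ‖ ^ 2 := by
  rw [norm_mul, mul_pow, Complex.norm_real, Real.norm_eq_abs, sq_abs, fracSymbol_sq]
  ring

/-- The transform of f is always square integrable, so only the summand |ξ|^{2s} of the weight
matters: H^s is the exact domain of the multiplier. -/
lemma memHs_iff (s : ℝ) (f : L2 d) :
    MemHs s f ↔ MemLp (fun ξ => (fracSymbol d s ξ : ℂ) * (𝓕 f : L2 d) ξ) 2 volume := by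
  have hmeas : AEStronglyMeasurable (fun ξ => (fracSymbol d s ξ : ℂ) * (𝓕 f : L2 d) ξ) volume :=
    (Complex.measurable_ofReal.comp (measurable_fracSymbol d s)).aestronglyMeasurable.mul
      (Lp.aestronglyMeasurable _)
  rw [memLp_two_iff_integrable_sq_norm hmeas, MemHs]
  simp_rw [sobolev_integrand_eq]
  exact integrable_add_iff_integrable_right' (integrable_norm_sq _)

lemma hsNorm_sq {s : ℝ} {f : L2 d} (hf : MemHs s f) :
    hsNorm s f ^ 2 = ‖f‖ ^ 2 + ‖fracLaplacian (s / 2) f‖ ^ 2 := by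
  have h := (memHs_iff s f).1 hf
  have h1 : ‖fracLaplacian (s / 2) f‖ ^ 2
      = ∫ ξ, ‖(fracSymbol d s ξ : ℂ) * (𝓕 f : L2 d) ξ‖ ^ 2 := by
    have h2 : fracLaplacian (s / 2) f = 𝓕⁻ (h.toLp _) := dif_pos h
    have h3 : ‖(𝓕⁻ (h.toLp _) : L2 d)‖ = ‖h.toLp _‖ :=
      (Lp.fourierTransformₗᵢ (Rn d) ℂ).symm.norm_map _
    rw [h2, h3, norm_sq_eq_integral]
    refine integral_congr_ae ?_
    filter_upwards [h.coeFn_toLp] with ξ hξ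
    rw [hξ]
  have h4 : ‖f‖ ^ 2 = ∫ ξ, ‖(𝓕 f : L2 d) ξ‖ ^ 2 := by
    rw [← norm_sq_eq_integral, Lp.norm_fourier_eq]
  rw [hsNorm, Real.sq_sqrt (integral_nonneg fun ξ => by positivity), h1, h4,
    ← integral_add (integrable_norm_sq _)
      ((memLp_two_iff_integrable_sq_norm h.aestronglyMeasurable).1 h)]
  simp_rw [sobolev_integrand_eq]

lemma hsNorm_nonneg (s : ℝ) (f : L2 d) : 0 ≤ hsNorm s f := Real.sqrt_nonneg _

lemma norm_le_hsNorm {s : ℝ} {f : L2 d} (hf : MemHs s f) : ‖f‖ ≤ hsNorm s f :=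
  abs_le_of_sq_le_sq' (by rw [hsNorm_sq hf]; linarith [sq_nonneg ‖fracLaplacian (s / 2) f‖])
    (hsNorm_nonneg s f) |>.2

lemma norm_fracLaplacian_le_hsNorm {s : ℝ} {f : L2 d} (hf : MemHs s f) :
    ‖fracLaplacian (s / 2) f‖ ≤ hsNorm s f :=
  abs_le_of_sq_le_sq' (by rw [hsNorm_sq hf]; linarith [sq_nonneg ‖f‖]) (hsNorm_nonneg s f) |>.2

lemma hsNorm_le {s : ℝ} {f : L2 d} (hf : MemHs s f) :
    hsNorm s f ≤ ‖f‖ + ‖fracLaplacian (s / 2) f‖ := by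
  refine abs_le_of_sq_le_sq' ?_ (by positivity) |>.2
  rw [hsNorm_sq hf]
  nlinarith [mul_nonneg (norm_nonneg f) (norm_nonneg (fracLaplacian (s / 2) f))]

/-- The fractional Laplacian `(-Δ)^{s/2}` generates a unitary group in `L²`. -/
theorem exists_isWaveGroup_fracLaplacian (d : ℕ) (s : ℝ) :
    ∃ U : ℝ → L2 d →ₗᵢ[ℂ] L2 d, IsWaveGroup (MemHs s) (fracLaplacian (s / 2)) U := by
  have h := (isWaveGroup_mulOp (μ := (volume : Measure (Rn d))) (measurable_fracSymbol d s)
    (fracSymbol_nonneg s)).conj (Lp.fourierTransformₗᵢ (Rn d) ℂ)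
  have hD : (fun f : L2 d => MemLp (fun ξ => (fracSymbol d s ξ : ℂ) *
      Lp.fourierTransformₗᵢ (Rn d) ℂ f ξ) 2 volume) = MemHs s := by
    funext f
    exact propext (memHs_iff s f).symm
  have hΛ : (fun f : L2 d => (Lp.fourierTransformₗᵢ (Rn d) ℂ).symm (mulOp (fracSymbol d s)
      (Lp.fourierTransformₗᵢ (Rn d) ℂ f))) = fracLaplacian (s / 2) := by
    funext f
    by_cases hf : MemLp (fun ξ => (fracSymbol d s ξ : ℂ) * (𝓕 f : L2 d) ξ) 2 volume
    · have h1 : fracLaplacian (s / 2) f = 𝓕⁻ (hf.toLp _) := dif_pos hf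
      have h2 : mulOp (fracSymbol d s) (𝓕 f : L2 d) = hf.toLp _ := dif_pos hf
      exact (congrArg _ h2).trans h1.symm
    -- Both operators take the default value 0 off the domain, so they agree on all of L².
    · have h1 : fracLaplacian (s / 2) f = 0 := dif_neg hf
      have h2 : mulOp (fracSymbol d s) (𝓕 f : L2 d) = 0 := dif_neg hf
      rw [h1]
      exact (congrArg _ h2).trans (map_zero (Lp.fourierTransformₗᵢ (Rn d) ℂ).symm)
  rw [hD, hΛ] at h
  exact ⟨_, h⟩

/-! ### Bounded coefficients as operators on L² -/

/-- Multiplication by a bounded function. -/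
noncomputable def mulLinf (a : Linf d) : L2 d →L[ℝ] L2 d :=
  LinearMap.mkContinuous
    { toFun := fun f => (a • f : L2 d)
      map_add' := fun f g => Lp.add_smul a f g
      map_smul' := fun c f => (Lp.smul_comm c a f).symm } ‖a‖ fun f => Lp.norm_smul_le a f

lemma mulLinf_apply (a : Linf d) (f : L2 d) : mulLinf a f = (a • f : L2 d) := rfl

lemma norm_mulLinf_apply_le (a : Linf d) (f : L2 d) : ‖mulLinf a f‖ ≤ ‖a‖ * ‖f‖ :=
  Lp.norm_smul_le a f

lemma coeFn_mulLinf (a : Linf d) (f : L2 d) :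
    mulLinf a f =ᵐ[volume] fun x => (a x : ℂ) * f x := by
  filter_upwards [Lp.coeFn_lpSMul (r := 2) a f] with x hx
  rw [mulLinf_apply, hx, Pi.smul_apply', Complex.real_smul]

lemma inner_mulLinf (a : Linf d) (f g : L2 d) :
    inner ℂ f (mulLinf a g) = inner ℂ (mulLinf a f) g := by
  refine inner_eq_inner_of_ae ?_
  filter_upwards [coeFn_mulLinf a f, coeFn_mulLinf a g] with x e1 e2
  rw [e1, e2]
  simp only [RCLike.inner_apply, map_mul, Complex.conj_ofReal]
  ring

lemma inner_mulLinf_self_nonneg {a : Linf d} (ha : 0 ≤ a) (f : L2 d) :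
    0 ≤ (inner ℂ f (mulLinf a f)).re := by
  have h1 : inner ℂ f (mulLinf a f) = ((∫ x, a x * ‖f x‖ ^ 2 : ℝ) : ℂ) := by
    rw [L2.inner_def, ← integral_complex_ofReal]
    refine integral_congr_ae ?_
    filter_upwards [coeFn_mulLinf a f] with x e1
    rw [e1, RCLike.inner_apply, mul_assoc, RCLike.mul_conj]
    push_cast
    rfl
  rw [h1, Complex.ofReal_re]
  refine integral_nonneg_of_ae ?_
  filter_upwards [(Lp.coeFn_nonneg a).2 ha] with x hx
  exact mul_nonneg hx (by positivity)

/-! ### Solutions -/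

variable {s T : ℝ} {a b : Linf d} {u₀ u₁ : L2 d}

lemma IsSolution.isWeakSolution {u : ℝ → L2 d} {U : ℝ → L2 d →ₗᵢ[ℂ] L2 d}
    (hU : IsWaveGroup (MemHs s) (fracLaplacian (s / 2)) U) (hT : 0 < T)
    (hu : IsSolution s T a b u₀ u₁ u) :
    IsWeakSolution (MemHs s) (fracLaplacian (s / 2)) (mulLinf a) (mulLinf b) T u (timeDeriv T u) := by
  have hC := (contDiffOn_one_iff_derivWithin (uniqueDiffOn_Icc hT)).1 hu.inEnergySpace.contDiffOn
  have hmem := hu.inEnergySpace.memHs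
  refine ⟨hmem, fun t ht => ?_, fun t ht => (hC.1 t ht).hasDerivWithinAt, hC.2, hu.equation⟩
  rw [ContinuousWithinAt, tendsto_iff_norm_sub_tendsto_zero]
  refine squeeze_zero' (.of_forall fun _ => norm_nonneg _) ?_
    (hu.inEnergySpace.continuous_hs t ht)
  filter_upwards [self_mem_nhdsWithin] with τ hτ
  have h1 := hU.sub (hmem τ hτ) (hmem t ht)
  rw [← h1.2]
  exact norm_fracLaplacian_le_hsNorm h1.1

lemma IsWeakSolution.isSolution {u v : ℝ → L2 d} {U : ℝ → L2 d →ₗᵢ[ℂ] L2 d}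
    (hU : IsWaveGroup (MemHs s) (fracLaplacian (s / 2)) U) (hT : 0 < T)
    (hu : IsWeakSolution (MemHs s) (fracLaplacian (s / 2)) (mulLinf a) (mulLinf b) T u v) :
    IsSolution s T a b (u 0) (v 0) u := by
  have hv : ∀ t ∈ Icc 0 T, timeDeriv T u t = v t := fun t ht =>
    (hu.hasDerivWithinAt t ht).derivWithin (uniqueDiffOn_Icc hT t ht)
  refine ⟨⟨hu.mem, fun t ht => ?_, ?_⟩, fun φ hφ t ht => ?_, rfl, hv 0 ⟨le_rfl, hT.le⟩⟩
  · have h1 : Tendsto (fun τ => ‖u τ - u t‖ + ‖fracLaplacian (s / 2) (u τ)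
        - fracLaplacian (s / 2) (u t)‖) (𝓝[Icc 0 T] t) (𝓝 (0 + 0)) :=
      (tendsto_iff_norm_sub_tendsto_zero.1 (hu.continuousOn_self t ht)).add
        (tendsto_iff_norm_sub_tendsto_zero.1 (hu.continuousOn t ht))
    rw [add_zero] at h1
    refine squeeze_zero' (.of_forall fun _ => hsNorm_nonneg _ _) ?_ h1
    filter_upwards [self_mem_nhdsWithin] with τ hτ
    have h2 := hU.sub (hu.mem τ hτ) (hu.mem t ht)
    rw [← h2.2]
    exact hsNorm_le h2.1
  · rw [contDiffOn_one_iff_derivWithin (uniqueDiffOn_Icc hT)]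
    exact ⟨fun t ht => (hu.hasDerivWithinAt t ht).differentiableWithinAt,
      hu.continuousOn_deriv.congr hv⟩
  · rw [hv t ht]
    exact (hu.equation φ hφ t ht).congr_of_mem (fun τ hτ => by rw [hv τ hτ]) ht

/-- The Cauchy problem with bounded coefficients has a solution. -/
theorem exists_isSolution (hT : 0 < T) (a b : Linf d) (hu₀ : MemHs s u₀) (u₁ : L2 d) :
    ∃ u, IsSolution s T a b u₀ u₁ u := by
  obtain ⟨U, hU⟩ := exists_isWaveGroup_fracLaplacian d s
  obtain ⟨u, v, hu, rfl, rfl⟩ := hU.exists_isWeakSolution hT.le (mulLinf a) (mulLinf b) hu₀ u₁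
  exact ⟨u, hu.isSolution hU hT⟩

/-- The energy estimate. -/
theorem IsSolution.energyNorm_le {u : ℝ → L2 d} (hT : 0 < T) (ha : 0 ≤ a) (hb : 0 ≤ b)
    (hu : IsSolution s T a b u₀ u₁ u) {t : ℝ} (ht : t ∈ Icc 0 T) :
    energyNorm s T u t ≤ hsNorm s u₀ + (2 + T) * (‖u₁‖ + hsNorm s u₀ + (1 + ‖a‖) * hsNorm s u₀) := by
  obtain ⟨U, hU⟩ := exists_isWaveGroup_fracLaplacian d s
  have hw := hu.isWeakSolution hU hT
  have h0 : (0 : ℝ) ∈ Icc 0 T := ⟨le_rfl, hT.le⟩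
  have hu₀ : MemHs s u₀ := hu.initial ▸ hw.mem 0 h0
  set h := hsNorm s u₀ with hh
  have hh0 : 0 ≤ h := hsNorm_nonneg _ _
  -- M² dominates the initial energy: ⟨u₀, a u₀⟩ ≤ ‖a‖h² ≤ ((1 + ‖a‖)h)². This avoids a square root
  -- of ‖a‖, so M is polynomial in the data.
  set M := ‖u₁‖ + h + (1 + ‖a‖) * h with hM
  have hM0 : 0 ≤ M := by positivity
  have hE : ∀ τ ∈ Icc 0 T,
      ‖timeDeriv T u τ‖ ^ 2 + ‖fracLaplacian (s / 2) (u τ)‖ ^ 2 ≤ M ^ 2 := by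
    intro τ hτ
    have h1 := hw.energy_le hU hT.le (inner_mulLinf a) (inner_mulLinf_self_nonneg hb) hτ
    rw [hu.initial, hu.initial_deriv] at h1
    have h2 := inner_mulLinf_self_nonneg ha (u τ)
    have h3 : (inner ℂ u₀ (mulLinf a u₀)).re ≤ ((1 + ‖a‖) * h) ^ 2 := by
      calc (inner ℂ u₀ (mulLinf a u₀)).re ≤ ‖u₀‖ * ‖mulLinf a u₀‖ :=
            re_inner_le_norm (𝕜 := ℂ) _ _
        _ ≤ ‖u₀‖ * (‖a‖ * ‖u₀‖) := by gcongr; exact norm_mulLinf_apply_le a u₀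
        _ ≤ h * (‖a‖ * h) := by
            have := norm_le_hsNorm hu₀
            gcongr
        _ = ‖a‖ * h ^ 2 := by ring
        _ ≤ (1 + ‖a‖) ^ 2 * h ^ 2 := by
            gcongr
            nlinarith [norm_nonneg a]
        _ = _ := by ring
    have h4 : ‖fracLaplacian (s / 2) u₀‖ ^ 2 ≤ h ^ 2 := by
      gcongr
      exact norm_fracLaplacian_le_hsNorm hu₀
    have h5 : 0 ≤ (1 + ‖a‖) * h := by positivity
    have h6 : M ^ 2 = ‖u₁‖ ^ 2 + h ^ 2 + ((1 + ‖a‖) * h) ^ 2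
        + 2 * (‖u₁‖ * h + ‖u₁‖ * ((1 + ‖a‖) * h) + h * ((1 + ‖a‖) * h)) := by
      rw [hM]; ring
    have h7 : 0 ≤ ‖u₁‖ * h + ‖u₁‖ * ((1 + ‖a‖) * h) + h * ((1 + ‖a‖) * h) := by positivity
    linarith
  have hv : ∀ τ ∈ Icc 0 T, ‖timeDeriv T u τ‖ ≤ M := fun τ hτ =>
    (abs_le_of_sq_le_sq' (by linarith [hE τ hτ, sq_nonneg ‖fracLaplacian (s / 2) (u τ)‖]) hM0).2
  have hΛ : ‖fracLaplacian (s / 2) (u t)‖ ≤ M :=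
    (abs_le_of_sq_le_sq' (by linarith [hE t ht, sq_nonneg ‖timeDeriv T u t‖]) hM0).2
  -- The energy need not control ‖u‖, so u' is integrated in time; this gives the T in the factor 2
  -- + T, while u' and Λu give the 2.
  have hut : ‖u t‖ ≤ h + M * T := by
    have h1 := Convex.norm_image_sub_le_of_norm_hasDerivWithin_le hw.hasDerivWithinAt hv
      (convex_Icc 0 T) h0 ht
    rw [hu.initial, sub_zero, Real.norm_of_nonneg ht.1] at h1
    have h2 : M * t ≤ M * T := by gcongr; exact ht.2
    have h3 : ‖u t‖ ≤ ‖u₀‖ + ‖u t - u₀‖ := by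
      simpa using norm_add_le u₀ (u t - u₀)
    linarith [norm_le_hsNorm hu₀]
  rw [energyNorm]
  linarith [hv t ht]

/-! ### Moderate nets of real numbers -/

/-- Nets of real numbers bounded by `C ε^{-N}`. -/
def ModerateBound (f : ℝ → ℝ) : Prop :=
  ∃ N : ℕ, ∃ C : ℝ, 0 < C ∧ ∀ ε ∈ Ioc (0 : ℝ) 1, f ε ≤ C * (ε ^ N)⁻¹

namespace ModerateBound

variable {f g : ℝ → ℝ}

lemma const (c : ℝ) : ModerateBound fun _ => c :=
  ⟨0, |c| + 1, by positivity, fun ε _ => by simpa using (le_abs_self c).trans (by linarith)⟩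

lemma add (hf : ModerateBound f) (hg : ModerateBound g) : ModerateBound fun ε => f ε + g ε := by
  obtain ⟨N, C, hC, hf⟩ := hf
  obtain ⟨N', C', hC', hg⟩ := hg
  refine ⟨N + N', C + C', by positivity, fun ε hε => ?_⟩
  have h1 : (ε ^ N)⁻¹ ≤ (ε ^ (N + N'))⁻¹ :=
    inv_anti₀ (pow_pos hε.1 _) (pow_le_pow_of_le_one hε.1.le hε.2 (by omega))
  have h2 : (ε ^ N')⁻¹ ≤ (ε ^ (N + N'))⁻¹ :=
    inv_anti₀ (pow_pos hε.1 _) (pow_le_pow_of_le_one hε.1.le hε.2 (by omega))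
  calc f ε + g ε ≤ C * (ε ^ N)⁻¹ + C' * (ε ^ N')⁻¹ := add_le_add (hf ε hε) (hg ε hε)
    _ ≤ C * (ε ^ (N + N'))⁻¹ + C' * (ε ^ (N + N'))⁻¹ := by gcongr
    _ = _ := by ring

/-- Upper bounds multiply once g is nonnegative; f may have any sign, as its bound is positive. -/
lemma mul (hf : ModerateBound f) (hg : ModerateBound g) (hg0 : ∀ ε, 0 ≤ g ε) :
    ModerateBound fun ε => f ε * g ε := by
  obtain ⟨N, C, hC, hf⟩ := hf
  obtain ⟨N', C', hC', hg⟩ := hg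
  refine ⟨N + N', C * C', by positivity, fun ε hε => ?_⟩
  have h1 := pow_pos hε.1 N
  calc f ε * g ε ≤ (C * (ε ^ N)⁻¹) * (C' * (ε ^ N')⁻¹) :=
        mul_le_mul (hf ε hε) (hg ε hε) (hg0 ε) (by positivity)
    _ = _ := by rw [pow_add, mul_inv]; ring

end ModerateBound

/-- Nets of solutions of the regularised problems are moderate. -/
theorem SolvesRegularised.moderateEnergy {aε bε : ℝ → Linf d} {u₀ε u₁ε : ℝ → L2 d}
    {u : ℝ → ℝ → L2 d} (hT : 0 < T) (hd : IsModerateData s aε bε u₀ε u₁ε)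
    (hu : SolvesRegularised s T aε bε u₀ε u₁ε u) : ModerateEnergy s T u := by
  refine ⟨fun ε hε => (hu ε hε).inEnergySpace, ?_⟩
  have h0 : ModerateBound fun ε => hsNorm s (u₀ε ε) := hd.moderate_u₀.2
  have h1 : ModerateBound fun ε => ‖u₁ε ε‖ := hd.moderate_u₁
  have ha : ModerateBound fun ε => ‖aε ε‖ := hd.moderate_a
  have hn : ∀ ε, 0 ≤ hsNorm s (u₀ε ε) := fun ε => hsNorm_nonneg _ _
  obtain ⟨N, C, hC, h⟩ := h0.add ((ModerateBound.const (2 + T)).mul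
    ((h1.add h0).add (((ModerateBound.const 1).add ha).mul h0 hn))
    fun ε => by have := hn ε; positivity)
  exact ⟨N, C, hC, fun ε hε t ht =>
    ((hu ε hε).energyNorm_le hT (hd.nonneg_a ε hε) (hd.nonneg_b ε hε) ht).trans (h ε hε)⟩

/-- The regularised problems are solvable. -/
theorem IsModerateData.exists_solvesRegularised {aε bε : ℝ → Linf d} {u₀ε u₁ε : ℝ → L2 d}
    (hT : 0 < T) (hd : IsModerateData s aε bε u₀ε u₁ε) :
    ∃ u : ℝ → ℝ → L2 d, SolvesRegularised s T aε bε u₀ε u₁ε u := by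
  -- Stated for all real ε so that choice yields a net; the value 0 outside (0, 1] is irrelevant.
  have h : ∀ ε, ∃ u : ℝ → L2 d, ε ∈ Ioc (0 : ℝ) 1 →
      IsSolution s T (aε ε) (bε ε) (u₀ε ε) (u₁ε ε) u := fun ε => by
    by_cases hε : ε ∈ Ioc (0 : ℝ) 1
    · obtain ⟨u, hu⟩ := exists_isSolution hT (aε ε) (bε ε) (hd.moderate_u₀.1 ε hε) (u₁ε ε)
      exact ⟨u, fun _ => hu⟩
    · exact ⟨0, fun h => absurd h hε⟩
  choose u hu using h
  exact ⟨u, hu⟩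

end VeryWeak

open VeryWeak
theorem theorem3p1 (d : ℕ) (s T : ℝ) (hs : 0 < s) (hT : 0 < T) :
    (∀ (aε bε : ℝ → Linf d) (u₀ε u₁ε : ℝ → L2 d), IsModerateData s aε bε u₀ε u₁ε →
      (∃ u : ℝ → ℝ → L2 d, SolvesRegularised s T aε bε u₀ε u₁ε u) ∧
        ∀ u : ℝ → ℝ → L2 d, SolvesRegularised s T aε bε u₀ε u₁ε u → ModerateEnergy s T u) ∧
    ∀ (a b : SingularFunction d ℝ) (u₀ u₁ : SingularFunction d ℂ),
      (∃ (aε bε : ℝ → Linf d) (u₀ε u₁ε : ℝ → L2 d),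
        IsModerateApproximation s a b u₀ u₁ aε bε u₀ε u₁ε) →
      ∃ u : ℝ → ℝ → L2 d, IsVeryWeakSolution s T a b u₀ u₁ u := by
  refine ⟨fun aε bε u₀ε u₁ε hd => ⟨hd.exists_solvesRegularised hT, fun u hu =>
    hu.moderateEnergy hT hd⟩, ?_⟩
  rintro a b u₀ u₁ ⟨aε, bε, u₀ε, u₁ε, happ⟩
  obtain ⟨u, hu⟩ := happ.moderate.exists_solvesRegularised hT
  exact ⟨u, aε, bε, u₀ε, u₁ε, happ, hu, hu.moderateEnergy hT happ.moderate⟩
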